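/- All manifolds, maps and tensor fields are smooth. Let $(N^{m+1},h)$ be an Einstein space, i.e. a Riemannian manifold with $\mathrm{Ric}^N=\frac{r}{m+1}\,h$, where $r$ is its scalar curvature, and let $\varphi:(M^m,g)\to(N^{m+1},h)$ be a totally umbilical hypersurface: $\varphi$ is an isometric immersion and at each point $p\in M$ the shape operator with respect to a unit normal vector $\xi$, defined by $\langle AX,Y\rangle=\langle\nabla\mathrm d\varphi(X,Y),\xi\rangle$, is a multiple $A=\lambda(p)\,\mathrm{Id}$ of the identity. Call $\varphi$ biharmonic if its bitension field $$\tau^2(\varphi)=\mathrm{Trace}_g(\nabla^{\varphi}\nabla^{\varphi}-\nabla^{\varphi}_{\nabla^{M}})\tau(\varphi)-\mathrm{Trace}_g R^N(\mathrm d\varphi,\tau(\varphi))\,\mathrm d\varphi$$ vanishes identically, where $\tau(\varphi)=\mathrm{Trace}_g\nabla\mathrm d\varphi$ and $R^N(X,Y)Z=[\nabla^N_X,\nabla^N_Y]Z-\nabla^N_{[X,Y]}Z$, and minimal if its mean curvature $H=\frac1m\mathrm{Trace}\,A$ vanishes identically. (1) If $r\le 0$ on $N$, then $\varphi$ is biharmonic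 if and only if it is minimal. (2) Let $m\ge1$, with no assumption on the sign of $r$. If $\varphi$ is biharmonic, $U\subseteq M$ is open and connected, $\xi$ is a smooth unit normal vector field along $\varphi$ on $U$, and $A=\lambda\,\mathrm{Id}$ on $U$ with respect to $\xi$, then $\lambda$ is constant on $U$, and either $\lambda=0$ on $U$, or at every point $p$ of $U$ one has $r(\varphi(p))\ge0$ and $\lambda=\pm\sqrt{\frac{r(\varphi(p))}{m(m+1)}}$. -/

import Mathlib

open scoped Manifold ContDiff

namespace BihHyp

noncomputable section

/-- The coordinate space `ℝⁿ`, on which the manifolds below are modelled. -/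
abbrev Coord (n : ℕ) : Type := EuclideanSpace ℝ (Fin n)

/-- A smooth Riemannian metric on the tangent bundle of an `n`-dimensional smooth manifold. -/
abbrev Metric (n : ℕ) (M : Type*) [TopologicalSpace M] [ChartedSpace (Coord n) M]
    [IsManifold (𝓡 n) ∞ M] :=
  Bundle.ContMDiffRiemannianMetric (𝓡 n) ∞ (Coord n) (fun p : M => TangentSpace (𝓡 n) p)

/-! ### Riemannian geometry in coordinates -/

/-- The partial derivative `∂ᵢ f`. -/
def pderiv {n : ℕ} (i : Fin n) (f : Coord n → ℝ) (x : Coord n) : ℝ :=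
  fderiv ℝ f x (EuclideanSpace.single i 1)

/-- The Christoffel symbol
`Γᵏᵢⱼ = ½ ∑ₗ gᵏˡ (∂ᵢ gⱼₗ + ∂ⱼ gᵢₗ - ∂ₗ gᵢⱼ)` of the coordinate metric `G = (gᵢⱼ)`. -/
def christoffel {n : ℕ} (G : Coord n → Matrix (Fin n) (Fin n) ℝ) (k i j : Fin n)
    (x : Coord n) : ℝ :=
  (1 / 2 : ℝ) * ∑ l, (G x)⁻¹ k l *
    (pderiv i (fun z => G z j l) x + pderiv j (fun z => G z i l) x
      - pderiv l (fun z => G z i j) x)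

/-- The component along `∂ₗ` of `R(∂ᵢ, ∂ⱼ)∂ₖ`, where
`R(X, Y)Z = ∇_X ∇_Y Z - ∇_Y ∇_X Z - ∇_[X,Y] Z`. -/
def curvature {n : ℕ} (G : Coord n → Matrix (Fin n) (Fin n) ℝ) (l i j k : Fin n)
    (x : Coord n) : ℝ :=
  pderiv i (christoffel G l j k) x - pderiv j (christoffel G l i k) x
    + ∑ s, (christoffel G l i s x * christoffel G s j k x
      - christoffel G l j s x * christoffel G s i k x)

/-- The Ricci tensor `Ric(Y, Z) = trace (X ↦ R(X, Y)Z)` of a coordinate metric. -/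
def ricci {n : ℕ} (G : Coord n → Matrix (Fin n) (Fin n) ℝ) (x : Coord n) :
    Matrix (Fin n) (Fin n) ℝ :=
  Matrix.of fun j k => ∑ i, curvature G i i j k x

/-- The scalar curvature `r = ∑ gʲᵏ Ricⱼₖ` of a coordinate metric. -/
def scalar {n : ℕ} (G : Coord n → Matrix (Fin n) (Fin n) ℝ) (x : Coord n) : ℝ :=
  ∑ j, ∑ k, (G x)⁻¹ j k * ricci G x j k

/-- The component `γ` of the second fundamental form
`∇dφ(∂ᵢ, ∂ⱼ) = ∇^φ_{∂ᵢ} (dφ(∂ⱼ)) - dφ(∇ᴹ_{∂ᵢ} ∂ⱼ)` of the coordinate map `u`, for the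
coordinate metrics `G` on the source and `H` on the target. -/
def hessMap {m n : ℕ} (G : Coord m → Matrix (Fin m) (Fin m) ℝ)
    (H : Coord n → Matrix (Fin n) (Fin n) ℝ) (u : Coord m → Coord n)
    (i j : Fin m) (x : Coord m) (γ : Fin n) : ℝ :=
  pderiv i (pderiv j (fun z => u z γ)) x
    - ∑ k, christoffel G k i j x * pderiv k (fun z => u z γ) x
    + ∑ α, ∑ β, christoffel H γ α β (u x)
        * pderiv i (fun z => u z α) x * pderiv j (fun z => u z β) x

/-- The tension field `τ = trace_g ∇dφ` in coordinates. -/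
def tension {m n : ℕ} (G : Coord m → Matrix (Fin m) (Fin m) ℝ)
    (H : Coord n → Matrix (Fin n) (Fin n) ℝ) (u : Coord m → Coord n)
    (x : Coord m) (γ : Fin n) : ℝ :=
  ∑ i, ∑ j, (G x)⁻¹ i j * hessMap G H u i j x γ

/-- The covariant derivative `∇^φ_{∂ᵢ} V` of a vector field `V` along the map, in coordinates. -/
def covDeriv {m n : ℕ} (H : Coord n → Matrix (Fin n) (Fin n) ℝ) (u : Coord m → Coord n)
    (i : Fin m) (V : Coord m → Fin n → ℝ) (x : Coord m) (γ : Fin n) : ℝ :=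
  pderiv i (fun z => V z γ) x
    + ∑ α, ∑ β, christoffel H γ α β (u x) * pderiv i (fun z => u z α) x * V x β

/-- The bitension field
`τ² = trace_g (∇^φ ∇^φ - ∇^φ_{∇ᴹ}) τ - trace_g Rᴺ(dφ, τ)dφ` in coordinates. -/
def bitension {m n : ℕ} (G : Coord m → Matrix (Fin m) (Fin m) ℝ)
    (H : Coord n → Matrix (Fin n) (Fin n) ℝ) (u : Coord m → Coord n)
    (x : Coord m) (γ : Fin n) : ℝ :=
  ∑ i, ∑ j, (G x)⁻¹ i j *
    (covDeriv H u i (covDeriv H u j (tension G H u)) x γ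
      - ∑ k, christoffel G k i j x * covDeriv H u k (tension G H u) x γ
      - ∑ α, ∑ β, ∑ δ, curvature H γ α β δ (u x)
          * pderiv i (fun z => u z α) x * tension G H u x β * pderiv j (fun z => u z δ) x)

/-! ### Passing to charts -/

section Charts

variable {m n : ℕ} {M N : Type*}
  [TopologicalSpace M] [ChartedSpace (Coord m) M] [IsManifold (𝓡 m) ∞ M]
  [TopologicalSpace N] [ChartedSpace (Coord n) N] [IsManifold (𝓡 n) ∞ N]

/-- The matrix `gᵢⱼ = g(∂ᵢ, ∂ⱼ)` of a Riemannian metric in a chart. -/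
def metricCoord (g : Metric n N) (e : OpenPartialHomeomorph N (Coord n)) (x : Coord n) :
    Matrix (Fin n) (Fin n) ℝ :=
  Matrix.of fun i j =>
    g.inner (e.symm x)
      (mfderiv (𝓡 n) (𝓡 n) e.symm x (EuclideanSpace.single i (1 : ℝ) : Coord n))
      (mfderiv (𝓡 n) (𝓡 n) e.symm x (EuclideanSpace.single j (1 : ℝ) : Coord n))

/-- The expression of a map in charts. -/
def mapCoord (φ : M → N) (e : OpenPartialHomeomorph M (Coord m))
    (e' : OpenPartialHomeomorph N (Coord n)) (x : Coord m) : Coord n :=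
  e' (φ (e.symm x))

/-- The components of a tangent vector in a chart. -/
def vecCoord (e' : OpenPartialHomeomorph N (Coord n)) {q : N} (v : TangentSpace (𝓡 n) q) :
    Coord n :=
  mfderiv (𝓡 n) (𝓡 n) e' q v

/-- The scalar curvature at a point, computed in the preferred chart at this point (its value
does not depend on the chart). -/
def scalarCurvature (h : Metric n N) (q : N) : ℝ :=
  scalar (metricCoord h (chartAt (Coord n) q)) (chartAt (Coord n) q q)

/-- An Einstein space: `Ric = (r / n) h`, where `r` is the scalar curvature and `n` the
dimension. -/
def IsEinstein (h : Metric n N) : Prop :=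
  ∀ e ∈ IsManifold.maximalAtlas (𝓡 n) ∞ N, ∀ q ∈ e.source,
    ricci (metricCoord h e) (e q)
      = (scalar (metricCoord h e) (e q) / (n : ℝ)) • metricCoord h e (e q)

/-- A smooth map with `φ^* h = g`. It is then automatically an immersion. -/
def IsIsometricImmersion (g : Metric m M) (h : Metric n N) (φ : M → N) : Prop :=
  ContMDiff (𝓡 m) (𝓡 n) ∞ φ ∧
    ∀ (p : M) (v w : TangentSpace (𝓡 m) p),
      h.inner (φ p) (mfderiv (𝓡 m) (𝓡 n) φ p v) (mfderiv (𝓡 m) (𝓡 n) φ p w) = g.inner p v w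

/-- A map is biharmonic if its bitension field vanishes identically. -/
def IsBiharmonic (g : Metric m M) (h : Metric n N) (φ : M → N) : Prop :=
  ∀ e ∈ IsManifold.maximalAtlas (𝓡 m) ∞ M, ∀ e' ∈ IsManifold.maximalAtlas (𝓡 n) ∞ N,
    ∀ p ∈ e.source, φ p ∈ e'.source →
      ∀ γ, bitension (metricCoord g e) (metricCoord h e') (mapCoord φ e e') (e p) γ = 0

/-- `ξ` is a unit normal vector of the immersed hypersurface at `p`. -/
def IsUnitNormal (h : Metric n N) (φ : M → N) (p : M) (ξ : TangentSpace (𝓡 n) (φ p)) : Prop :=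
  (∀ v : TangentSpace (𝓡 m) p, h.inner (φ p) ξ (mfderiv (𝓡 m) (𝓡 n) φ p v) = 0) ∧
    h.inner (φ p) ξ ξ = 1

/-- The matrix `bᵢⱼ = ⟨∇dφ(∂ᵢ, ∂ⱼ), ξ⟩` of the scalar second fundamental form at `p` with respect
to `ξ`, in charts. -/
def secondFundamental (g : Metric m M) (h : Metric n N) (φ : M → N) (p : M)
    (ξ : TangentSpace (𝓡 n) (φ p)) (e : OpenPartialHomeomorph M (Coord m))
    (e' : OpenPartialHomeomorph N (Coord n)) : Matrix (Fin m) (Fin m) ℝ :=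
  Matrix.of fun i j => ∑ γ, ∑ δ, metricCoord h e' (e' (φ p)) γ δ
    * hessMap (metricCoord g e) (metricCoord h e') (mapCoord φ e e') i j (e p) γ
    * vecCoord e' ξ δ

/-- The matrix `Aᵏⱼ = ∑ᵢ gᵏⁱ bᵢⱼ` of the shape operator at `p`, determined by
`⟨A X, Y⟩ = b(X, Y)`, in charts. -/
def shapeOperator (g : Metric m M) (h : Metric n N) (φ : M → N) (p : M)
    (ξ : TangentSpace (𝓡 n) (φ p)) (e : OpenPartialHomeomorph M (Coord m))
    (e' : OpenPartialHomeomorph N (Coord n)) : Matrix (Fin m) (Fin m) ℝ :=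
  (metricCoord g e (e p))⁻¹ * secondFundamental g h φ p ξ e e'

/-- The shape operator at `p` with respect to `ξ` is `lam` times the identity. -/
def IsUmbilicityFactor (g : Metric m M) (h : Metric n N) (φ : M → N) (p : M)
    (ξ : TangentSpace (𝓡 n) (φ p)) (lam : ℝ) : Prop :=
  ∀ e ∈ IsManifold.maximalAtlas (𝓡 m) ∞ M, ∀ e' ∈ IsManifold.maximalAtlas (𝓡 n) ∞ N,
    p ∈ e.source → φ p ∈ e'.source →
      shapeOperator g h φ p ξ e e' = lam • (1 : Matrix (Fin m) (Fin m) ℝ)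

/-- A totally umbilical hypersurface: at each point, all principal curvatures (with respect to a
unit normal vector there) are equal to the same number. -/
def IsTotallyUmbilical (g : Metric m M) (h : Metric n N) (φ : M → N) : Prop :=
  ∀ p : M, ∃ ξ : TangentSpace (𝓡 n) (φ p), IsUnitNormal (m := m) h φ p ξ ∧
    ∃ lam : ℝ, IsUmbilicityFactor g h φ p ξ lam

/-- A minimal hypersurface: the mean curvature `H = (1 / m) trace A` vanishes identically. -/
def IsMinimal (g : Metric m M) (h : Metric n N) (φ : M → N) : Prop :=
  ∀ (p : M) (ξ : TangentSpace (𝓡 n) (φ p)), IsUnitNormal (m := m) h φ p ξ →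
    ∀ e ∈ IsManifold.maximalAtlas (𝓡 m) ∞ M, ∀ e' ∈ IsManifold.maximalAtlas (𝓡 n) ∞ N,
      p ∈ e.source → φ p ∈ e'.source →
        (1 / (m : ℝ)) * (shapeOperator g h φ p ξ e e').trace = 0

end Charts

end

end BihHyp

open BihHyp

/-! The question is local, so it is settled in charts. The normal ν and the factor c are given only
point by point, without any regularity. The argument therefore runs on the tension field τ = m c ν
and on ρ = |τ|² = m²c², which are smooth and independent of the choice of ν.

Umbilicity and normality of the second fundamental form give ∇dφ = (1/m) g ⊗ τ
(`hessMap_eq_tension`). Differentiating ⟨τ, dφ(∂ⱼ)⟩ = 0 yields ⟨∇ᵢτ, dφ(∂ⱼ)⟩ = -(1/m) ρ gᵢⱼ. A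
second differentiation and a trace show that the rough Laplacian of τ, paired with dφ(∂ₗ), is
-(3/(2m)) ∂ₗρ. If Ric = κh at the point, with κ = r/(m+1), the curvature term of the bitension field
contributes κτ (`ip_bitension`), which is normal. Hence biharmonicity forces dρ = 0
(`pderiv_tensionSq_eq_zero`), without the Codazzi equation or constancy of r.

Where c ≠ 0, dρ = 0 makes ∇ᵢτ tangential, so ∇ᵢτ = -(ρ/m) dφ(∂ᵢ). Pairing the equation with τ gives
-ρ²/m + κρ = 0, that is mc² = κ (`factor_eq_zero_or`). If r ≤ 0 only c = 0 survives; conversely τ =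
0 kills every term of the bitension field. For (2), λ² is locally constant because ρ is, and λ =
(1/m)⟨τ, ξ⟩ is continuous, so λ cannot change sign on a connected set. -/

namespace BihHyp

/-! ### Partial derivatives of scalar, vector and matrix functions. -/

section Calculus

open scoped Matrix Topology

variable {n : ℕ} {f f₁ f₂ : Coord n → ℝ} {x : Coord n} {Ω : Set (Coord n)}

theorem pderiv_congr (i : Fin n) (h : f₁ =ᶠ[𝓝 x] f₂) : pderiv i f₁ x = pderiv i f₂ x := by
  rw [pderiv, pderiv, h.fderiv_eq]

theorem pderiv_const (i : Fin n) (c : ℝ) : pderiv i (fun _ => c) x = 0 := by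
  simp [pderiv]

theorem pderiv_const_mul (i : Fin n) (c : ℝ) (hf : DifferentiableAt ℝ f x) :
    pderiv i (fun z => c * f z) x = c * pderiv i f x := by
  simp [pderiv, fderiv_const_mul hf]

theorem pderiv_add (i : Fin n) (h₁ : DifferentiableAt ℝ f₁ x) (h₂ : DifferentiableAt ℝ f₂ x) :
    pderiv i (fun z => f₁ z + f₂ z) x = pderiv i f₁ x + pderiv i f₂ x := by
  simp [pderiv, fderiv_fun_add h₁ h₂]

theorem pderiv_mul (i : Fin n) (h₁ : DifferentiableAt ℝ f₁ x) (h₂ : DifferentiableAt ℝ f₂ x) :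
    pderiv i (fun z => f₁ z * f₂ z) x = pderiv i f₁ x * f₂ x + f₁ x * pderiv i f₂ x := by
  simp [pderiv, fderiv_fun_mul h₁ h₂]
  ring

theorem pderiv_sum {ι : Type*} (s : Finset ι) (i : Fin n) {F : ι → Coord n → ℝ}
    (h : ∀ a ∈ s, DifferentiableAt ℝ (F a) x) :
    pderiv i (fun z => ∑ a ∈ s, F a z) x = ∑ a ∈ s, pderiv i (F a) x := by
  simp [pderiv, fderiv_fun_sum h]

/-- This symmetry underlies both the skew-symmetry of the curvature and the symmetry of `hessMap`.
-/
theorem pderiv_comm (i j : Fin n) (h : ContDiffAt ℝ ∞ f x) :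
    pderiv i (pderiv j f) x = pderiv j (pderiv i f) x := by
  have hs : IsSymmSndFDerivAt ℝ f x := h.isSymmSndFDerivAt (by
    rw [minSmoothness_of_isRCLikeNormedField]; exact WithTop.coe_le_coe.2 (le_top : (2 : ℕ∞) ≤ ⊤))
  have hd : DifferentiableAt ℝ (fderiv ℝ f) x :=
    (h.fderiv_right (m := 1) (by norm_cast)).differentiableAt (by simp)
  have key (a b : Fin n) : pderiv a (pderiv b f) x
      = fderiv ℝ (fderiv ℝ f) x (EuclideanSpace.single a 1) (EuclideanSpace.single b 1) := by
    change fderiv ℝ (fun z => fderiv ℝ f z (EuclideanSpace.single b 1)) x _ = _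
    rw [fderiv_clm_apply hd (differentiableAt_const _)]
    simp
  rw [key, key, hs.eq]

theorem contDiffOn_pderiv (hΩ : IsOpen Ω) (i : Fin n) (hf : ContDiffOn ℝ ∞ f Ω) :
    ContDiffOn ℝ ∞ (pderiv i f) Ω :=
  (hf.fderiv_of_isOpen hΩ (m := ∞) (by simp)).clm_apply contDiffOn_const

theorem differentiableAt_of_contDiffOn {E F : Type*} [NormedAddCommGroup E] [NormedSpace ℝ E]
    [NormedAddCommGroup F] [NormedSpace ℝ F] {f : E → F} {Ω : Set E} {x : E}
    (hΩ : IsOpen Ω) (hf : ContDiffOn ℝ ∞ f Ω) (hx : x ∈ Ω) :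
    DifferentiableAt ℝ f x :=
  (hf.contDiffAt (hΩ.mem_nhds hx)).differentiableAt (by simp)

theorem fderiv_eq_sum_pderiv (x v : Coord n) : fderiv ℝ f x v = ∑ i, v i * pderiv i f x := by
  conv_lhs => rw [← (EuclideanSpace.basisFun (Fin n) ℝ).sum_repr v]
  simp [pderiv]

theorem pderiv_comp {m : ℕ} {u : Coord m → Coord n} {y : Coord m} (i : Fin m)
    (hf : DifferentiableAt ℝ f (u y)) (hu : DifferentiableAt ℝ u y) :
    pderiv i (fun z => f (u z)) y
      = ∑ α, pderiv i (fun z => u z α) y * pderiv α f (u y) := by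
  have h1 : pderiv i (fun z => f (u z)) y
      = fderiv ℝ f (u y) (fderiv ℝ u y (EuclideanSpace.single i 1)) := by
    change fderiv ℝ (f ∘ u) y _ = _
    rw [fderiv_comp y hf hu]
    rfl
  rw [h1, fderiv_eq_sum_pderiv]
  refine Finset.sum_congr rfl fun α _ => ?_
  congr 1
  have := (EuclideanSpace.proj (𝕜 := ℝ) α).hasFDerivAt.comp y hu.hasFDerivAt
  rw [pderiv]
  erw [this.fderiv]
  rfl

/-- The entrywise partial derivative of a matrix-valued function. -/
noncomputable def matDeriv {a b : Type*} (i : Fin n) (A : Coord n → Matrix a b ℝ) (x : Coord n) :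
    Matrix a b ℝ :=
  Matrix.of fun k l => pderiv i (fun z => A z k l) x

/-- The componentwise partial derivative of a vector-valued function. -/
noncomputable def vecDeriv {a : Type*} (i : Fin n) (V : Coord n → a → ℝ) (x : Coord n) : a → ℝ :=
  fun k => pderiv i (fun z => V z k) x

/-- Smoothness of all entries of a matrix-valued function. -/
def MatSmoothOn {a b : Type*} (A : Coord n → Matrix a b ℝ) (Ω : Set (Coord n)) : Prop :=
  ∀ k l, ContDiffOn ℝ ∞ (fun z => A z k l) Ω

/-- Smoothness of all components of a vector-valued function. -/
def VecSmoothOn {a : Type*} (V : Coord n → a → ℝ) (Ω : Set (Coord n)) : Prop :=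
  ∀ k, ContDiffOn ℝ ∞ (fun z => V z k) Ω

section Products

variable {a b c : Type*} [Fintype b]

theorem matDeriv_mul {A : Coord n → Matrix a b ℝ} {B : Coord n → Matrix b c ℝ} (i : Fin n)
    (hA : ∀ k l, DifferentiableAt ℝ (fun z => A z k l) x)
    (hB : ∀ k l, DifferentiableAt ℝ (fun z => B z k l) x) :
    matDeriv i (fun z => A z * B z) x = matDeriv i A x * B x + A x * matDeriv i B x := by
  ext k l
  simp only [matDeriv, Matrix.mul_apply, Matrix.of_apply, Matrix.add_apply]
  rw [pderiv_sum _ _ fun s _ => (hA k s).fun_mul (hB s l), ← Finset.sum_add_distrib]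
  exact Finset.sum_congr rfl fun s _ => pderiv_mul i (hA k s) (hB s l)

theorem vecDeriv_mulVec {A : Coord n → Matrix a b ℝ} {V : Coord n → b → ℝ} (i : Fin n)
    (hA : ∀ k l, DifferentiableAt ℝ (fun z => A z k l) x)
    (hV : ∀ k, DifferentiableAt ℝ (fun z => V z k) x) :
    vecDeriv i (fun z => A z *ᵥ V z) x = matDeriv i A x *ᵥ V x + A x *ᵥ vecDeriv i V x := by
  ext k
  simp only [vecDeriv, matDeriv, Matrix.mulVec, dotProduct, Matrix.of_apply, Pi.add_apply]
  rw [pderiv_sum _ _ fun s _ => (hA k s).fun_mul (hV s), ← Finset.sum_add_distrib]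
  exact Finset.sum_congr rfl fun s _ => pderiv_mul i (hA k s) (hV s)

theorem pderiv_dotProduct {V W : Coord n → b → ℝ} (i : Fin n)
    (hV : ∀ k, DifferentiableAt ℝ (fun z => V z k) x)
    (hW : ∀ k, DifferentiableAt ℝ (fun z => W z k) x) :
    pderiv i (fun z => V z ⬝ᵥ W z) x = vecDeriv i V x ⬝ᵥ W x + V x ⬝ᵥ vecDeriv i W x := by
  simp only [vecDeriv, dotProduct]
  rw [pderiv_sum _ _ fun s _ => (hV s).fun_mul (hW s), ← Finset.sum_add_distrib]
  exact Finset.sum_congr rfl fun s _ => pderiv_mul i (hV s) (hW s)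

theorem VecSmoothOn.dotProduct {V W : Coord n → b → ℝ} (hV : VecSmoothOn V Ω)
    (hW : VecSmoothOn W Ω) : ContDiffOn ℝ ∞ (fun z => V z ⬝ᵥ W z) Ω :=
  ContDiffOn.sum fun k _ => (hV k).mul (hW k)

theorem MatSmoothOn.mulVec {A : Coord n → Matrix a b ℝ} {V : Coord n → b → ℝ}
    (hA : MatSmoothOn A Ω) (hV : VecSmoothOn V Ω) : VecSmoothOn (fun z => A z *ᵥ V z) Ω :=
  fun k => ContDiffOn.sum fun l _ => (hA k l).mul (hV l)

end Products

theorem contDiffOn_det {ι : Type*} [Fintype ι] [DecidableEq ι] {A : Coord n → Matrix ι ι ℝ}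
    (hA : MatSmoothOn A Ω) : ContDiffOn ℝ ∞ (fun z => (A z).det) Ω := by
  simp only [Matrix.det_apply']
  exact ContDiffOn.sum fun σ _ => contDiffOn_const.mul (contDiffOn_prod fun k _ => hA _ _)

theorem MatSmoothOn.inv {ι : Type*} [Fintype ι] [DecidableEq ι] {A : Coord n → Matrix ι ι ℝ}
    (hA : MatSmoothOn A Ω) (hdet : ∀ z ∈ Ω, (A z).det ≠ 0) :
    MatSmoothOn (fun z => (A z)⁻¹) Ω := by
  intro k l
  simp only [Matrix.inv_def, Ring.inverse_eq_inv', Matrix.smul_apply, smul_eq_mul,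
    Matrix.adjugate_apply]
  refine ((contDiffOn_det hA).inv hdet).mul (contDiffOn_det fun s t => ?_)
  simp only [Matrix.updateRow_apply]
  split_ifs
  · exact contDiffOn_const
  · exact hA s t

end Calculus

/-! ### Levi-Civita connection and curvature of a coordinate metric. -/

section CoordMetric

open scoped Matrix Topology

variable {m n : ℕ} {x : Coord n} {Ω : Set (Coord n)} {G : Coord n → Matrix (Fin n) (Fin n) ℝ}

/-- A smooth, symmetric and nondegenerate matrix-valued function on an open set. -/
structure IsCoordMetric (G : Coord n → Matrix (Fin n) (Fin n) ℝ) (Ω : Set (Coord n)) : Prop where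
  isOpen : IsOpen Ω
  smooth : MatSmoothOn G Ω
  symm : ∀ x ∈ Ω, (G x).IsSymm
  det_ne : ∀ x ∈ Ω, (G x).det ≠ 0

/-- The matrix `(Γᵢ)ᵏⱼ` of Christoffel symbols. -/
noncomputable def christoffelMatrix (G : Coord n → Matrix (Fin n) (Fin n) ℝ) (i : Fin n)
    (x : Coord n) : Matrix (Fin n) (Fin n) ℝ :=
  Matrix.of fun k j => christoffel G k i j x

/-- The matrix of the curvature endomorphism `R(∂ᵢ, ∂ⱼ)`. -/
noncomputable def curvatureMatrix (G : Coord n → Matrix (Fin n) (Fin n) ℝ) (i j : Fin n)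
    (x : Coord n) : Matrix (Fin n) (Fin n) ℝ :=
  Matrix.of fun l k => curvature G l i j k x

/-- The matrix of the curvature endomorphism `R(X, Y)`. -/
noncomputable def curvatureOp (G : Coord n → Matrix (Fin n) (Fin n) ℝ) (x : Coord n)
    (X Y : Fin n → ℝ) : Matrix (Fin n) (Fin n) ℝ :=
  ∑ α, ∑ β, (X α * Y β) • curvatureMatrix G α β x

/-- In the form dΓ + Γ ∧ Γ, curvature identities become noncommutative matrix algebra. -/
theorem curvatureMatrix_eq (i j : Fin n) :
    curvatureMatrix G i j x = matDeriv i (christoffelMatrix G j) x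
      - matDeriv j (christoffelMatrix G i) x
      + (christoffelMatrix G i x * christoffelMatrix G j x
        - christoffelMatrix G j x * christoffelMatrix G i x) := by
  ext l k
  simp only [curvatureMatrix, matDeriv, christoffelMatrix, curvature, Matrix.of_apply,
    Matrix.add_apply, Matrix.sub_apply, Matrix.mul_apply, Finset.sum_sub_distrib]

theorem curvatureMatrix_swap (i j : Fin n) :
    curvatureMatrix G j i x = -curvatureMatrix G i j x := by
  rw [curvatureMatrix_eq, curvatureMatrix_eq]
  abel

/-- Antisymmetry of R in its first two arguments. It removes the normal direction from the Ricci
trace in `ricci_eq`. -/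
theorem curvatureOp_self_smul (X : Fin n → ℝ) (c : ℝ) : curvatureOp G x X (c • X) = 0 := by
  have h : curvatureOp G x X (c • X) = -curvatureOp G x X (c • X) := by
    conv_lhs => rw [curvatureOp, Finset.sum_comm]
    rw [curvatureOp, ← Finset.sum_neg_distrib]
    refine Finset.sum_congr rfl fun α _ => ?_
    rw [← Finset.sum_neg_distrib]
    refine Finset.sum_congr rfl fun β _ => ?_
    rw [curvatureMatrix_swap α β, smul_neg]
    simp only [Pi.smul_apply, smul_eq_mul]
    congr 2
    ring
  ext a b
  exact self_eq_neg.1 (congrFun (congrFun h a) b)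

namespace IsCoordMetric

variable (hG : IsCoordMetric G Ω)
include hG

theorem diff (hx : x ∈ Ω) (k l : Fin n) : DifferentiableAt ℝ (fun z => G z k l) x :=
  differentiableAt_of_contDiffOn hG.isOpen (hG.smooth k l) hx

theorem mul_inv (hx : x ∈ Ω) : G x * (G x)⁻¹ = 1 :=
  Matrix.mul_nonsing_inv _ (isUnit_iff_ne_zero.2 (hG.det_ne x hx))

theorem inv_mul (hx : x ∈ Ω) : (G x)⁻¹ * G x = 1 :=
  Matrix.nonsing_inv_mul _ (isUnit_iff_ne_zero.2 (hG.det_ne x hx))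

theorem inv_symm (hx : x ∈ Ω) : ((G x)⁻¹).IsSymm := by
  rw [Matrix.IsSymm, Matrix.transpose_nonsing_inv, hG.symm x hx]

theorem pderiv_symm (hx : x ∈ Ω) (k i j : Fin n) :
    pderiv k (fun z => G z i j) x = pderiv k (fun z => G z j i) x := by
  refine pderiv_congr k ?_
  filter_upwards [hG.isOpen.mem_nhds hx] with z hz
  exact (hG.symm z hz).apply j i

theorem christoffel_symm (hx : x ∈ Ω) (k i j : Fin n) :
    christoffel G k i j x = christoffel G k j i x := by
  rw [christoffel, christoffel]
  congr 1
  refine Finset.sum_congr rfl fun l _ => ?_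
  rw [hG.pderiv_symm hx l i j]
  ring

theorem smooth_christoffel (k i j : Fin n) : ContDiffOn ℝ ∞ (christoffel G k i j) Ω := by
  have hp (a b c : Fin n) := contDiffOn_pderiv hG.isOpen a (hG.smooth b c)
  exact contDiffOn_const.mul <| ContDiffOn.sum fun l _ =>
    (hG.smooth.inv hG.det_ne k l).mul (((hp i j l).add (hp j i l)).sub (hp l i j))

theorem diff_christoffel (hx : x ∈ Ω) (k i j : Fin n) :
    DifferentiableAt ℝ (christoffel G k i j) x :=
  differentiableAt_of_contDiffOn hG.isOpen (hG.smooth_christoffel k i j) hx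

theorem lower_christoffel (hx : x ∈ Ω) (i j l : Fin n) :
    ∑ k, G x l k * christoffel G k i j x
      = (1 / 2 : ℝ) * (pderiv i (fun z => G z j l) x + pderiv j (fun z => G z i l) x
        - pderiv l (fun z => G z i j) x) := by
  set c : Fin n → ℝ := fun l => pderiv i (fun z => G z j l) x + pderiv j (fun z => G z i l) x
    - pderiv l (fun z => G z i j) x with hc
  have h : (fun k => christoffel G k i j x) = (1 / 2 : ℝ) • ((G x)⁻¹ *ᵥ c) := by
    ext k
    simp [christoffel, Matrix.mulVec, dotProduct, hc]
  have h2 : (G x *ᵥ fun k => christoffel G k i j x) l = (1 / 2 : ℝ) * c l := by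
    rw [h, Matrix.mulVec_smul, Matrix.mulVec_mulVec, hG.mul_inv hx]
    simp
  exact h2

/-- The Levi-Civita connection is metric. -/
theorem matDeriv_eq (hx : x ∈ Ω) (i : Fin n) :
    matDeriv i G x = (christoffelMatrix G i x)ᵀ * G x + G x * christoffelMatrix G i x := by
  ext a b
  have h1 := hG.lower_christoffel hx i a b
  have h2 := hG.lower_christoffel hx i b a
  simp only [matDeriv, christoffelMatrix, Matrix.of_apply, Matrix.add_apply, Matrix.mul_apply,
    Matrix.transpose_apply]
  have h3 : ∑ k, christoffel G k i a x * G x k b = ∑ k, G x b k * christoffel G k i a x :=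
    Finset.sum_congr rfl fun k _ => by rw [(hG.symm x hx).apply, mul_comm]
  rw [h3, h1, h2, hG.pderiv_symm hx i b a, hG.pderiv_symm hx b i a, hG.pderiv_symm hx a i b,
    hG.pderiv_symm hx b a i]
  ring

theorem diff_christoffelMatrix (hx : x ∈ Ω) (i k l : Fin n) :
    DifferentiableAt ℝ (fun z => christoffelMatrix G i z k l) x :=
  hG.diff_christoffel hx k i l

theorem matDeriv_matDeriv (hx : x ∈ Ω) (i j : Fin n) :
    matDeriv i (matDeriv j G) x
      = (matDeriv i (christoffelMatrix G j) x)ᵀ * G x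
        + (christoffelMatrix G j x)ᵀ
          * ((christoffelMatrix G i x)ᵀ * G x + G x * christoffelMatrix G i x)
        + (((christoffelMatrix G i x)ᵀ * G x + G x * christoffelMatrix G i x)
            * christoffelMatrix G j x
          + G x * matDeriv i (christoffelMatrix G j) x) := by
  have hT := fun k l => hG.diff_christoffelMatrix hx j l k
  have h1 := matDeriv_mul i (A := fun z => (christoffelMatrix G j z)ᵀ) hT (hG.diff hx)
  have h2 := matDeriv_mul i (hG.diff hx) (hG.diff_christoffelMatrix hx j)
  rw [hG.matDeriv_eq hx i] at h1 h2
  have h3 : matDeriv i (matDeriv j G) x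
      = matDeriv i (fun z => (christoffelMatrix G j z)ᵀ * G z) x
        + matDeriv i (fun z => G z * christoffelMatrix G j z) x := by
    ext a b
    simp only [matDeriv, Matrix.of_apply, Matrix.add_apply]
    rw [← pderiv_add]
    · refine pderiv_congr i ?_
      filter_upwards [hG.isOpen.mem_nhds hx] with z hz
      exact congrFun (congrFun (hG.matDeriv_eq hz j) a) b
    · simp only [Matrix.mul_apply]
      exact DifferentiableAt.fun_sum fun s _ => (hT _ _).mul (hG.diff hx _ _)
    · simp only [Matrix.mul_apply]
      exact DifferentiableAt.fun_sum fun s _ =>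
        (hG.diff hx _ _).mul (hG.diff_christoffelMatrix hx _ _ _)
  rw [h3, h1, h2]
  rfl

/-- Antisymmetrize the formula for ∂ᵢ∂ⱼG in i and j. One side vanishes; on the other the mixed terms
ΓᵢᵀGΓⱼ + ΓⱼᵀGΓᵢ cancel, leaving RᵀG + GR. -/
theorem curvatureMatrix_skew (hx : x ∈ Ω) (i j : Fin n) :
    (curvatureMatrix G i j x)ᵀ * G x = -(G x * curvatureMatrix G i j x) := by
  have hsymm : matDeriv i (matDeriv j G) x = matDeriv j (matDeriv i G) x := by
    ext a b
    exact pderiv_comm i j ((hG.smooth a b).contDiffAt (hG.isOpen.mem_nhds hx))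
  rw [hG.matDeriv_matDeriv hx, hG.matDeriv_matDeriv hx] at hsymm
  rw [curvatureMatrix_eq, ← sub_eq_zero, ← sub_eq_zero.2 hsymm]
  simp only [Matrix.transpose_add, Matrix.transpose_sub, Matrix.transpose_mul]
  noncomm_ring

theorem curvatureOp_skew (hx : x ∈ Ω) (X Y : Fin n → ℝ) :
    (curvatureOp G x X Y)ᵀ * G x = -(G x * curvatureOp G x X Y) := by
  simp only [curvatureOp, Matrix.transpose_sum, Matrix.transpose_smul, Matrix.sum_mul,
    Matrix.mul_sum, Matrix.smul_mul, Matrix.mul_smul, hG.curvatureMatrix_skew hx,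
    ← Finset.sum_neg_distrib, smul_neg]

end IsCoordMetric

/-- The bilinear form of a matrix. -/
noncomputable abbrev ip (B : Matrix (Fin n) (Fin n) ℝ) : (Fin n → ℝ) →ₗ[ℝ] (Fin n → ℝ) →ₗ[ℝ] ℝ :=
  Matrix.toLinearMap₂' ℝ B

theorem ip_eq (B : Matrix (Fin n) (Fin n) ℝ) (v w : Fin n → ℝ) : ip B v w = v ⬝ᵥ B *ᵥ w :=
  Matrix.toLinearMap₂'_apply' B v w

theorem ip_eq_sum (B : Matrix (Fin n) (Fin n) ℝ) (v w : Fin n → ℝ) :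
    ip B v w = ∑ a, ∑ b, B a b * v a * w b := by
  rw [ip_eq]
  simp only [dotProduct, Matrix.mulVec, Finset.mul_sum]
  exact Finset.sum_congr rfl fun a _ => Finset.sum_congr rfl fun b _ => by ring

theorem ip_comm {B : Matrix (Fin n) (Fin n) ℝ} (hB : B.IsSymm) (v w : Fin n → ℝ) :
    ip B v w = ip B w v := by
  rw [ip_eq, ip_eq, Matrix.dotProduct_mulVec, ← Matrix.mulVec_transpose, hB, dotProduct_comm]

theorem ip_mulVec_left (A B : Matrix (Fin n) (Fin n) ℝ) (v w : Fin n → ℝ) :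
    ip B (A *ᵥ v) w = v ⬝ᵥ (Aᵀ * B) *ᵥ w := by
  rw [ip_eq, ← Matrix.mulVec_mulVec, Matrix.dotProduct_mulVec v, Matrix.vecMul_transpose]

theorem ip_mulVec_right (A B : Matrix (Fin n) (Fin n) ℝ) (v w : Fin n → ℝ) :
    ip B v (A *ᵥ w) = v ⬝ᵥ (B * A) *ᵥ w := by
  rw [ip_eq, Matrix.mulVec_mulVec]

theorem IsCoordMetric.ip_curvatureOp (hG : IsCoordMetric G Ω) (hx : x ∈ Ω)
    (X Y Z W : Fin n → ℝ) :
    ip (G x) (curvatureOp G x X Y *ᵥ Z) W = -ip (G x) (curvatureOp G x X Y *ᵥ W) Z := by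
  rw [ip_comm (hG.symm x hx) _ Z, ip_mulVec_left, ip_mulVec_right, hG.curvatureOp_skew hx,
    Matrix.neg_mulVec, dotProduct_neg]

end CoordMetric

/-! ### The pull-back connection along a coordinate map. -/

section AlongMap

open scoped Matrix Topology

variable {m n : ℕ} {x : Coord m} {Ω : Set (Coord m)} {Ω' : Set (Coord n)}
  {H : Coord n → Matrix (Fin n) (Fin n) ℝ} {u : Coord m → Coord n}

/-- The components of `du(∂ᵢ)`. -/
noncomputable def mapDeriv (u : Coord m → Coord n) (i : Fin m) (x : Coord m) : Fin n → ℝ :=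
  fun γ => pderiv i (fun z => u z γ) x

/-- The connection matrix of the pull-back connection in the direction `∂ᵢ`. -/
noncomputable def connectionMatrix (H : Coord n → Matrix (Fin n) (Fin n) ℝ) (u : Coord m → Coord n)
    (i : Fin m) (x : Coord m) : Matrix (Fin n) (Fin n) ℝ :=
  ∑ α, mapDeriv u i x α • christoffelMatrix H α (u x)

theorem covDeriv_eq (i : Fin m) (V : Coord m → Fin n → ℝ) :
    covDeriv H u i V x = vecDeriv i V x + connectionMatrix H u i x *ᵥ V x := by
  ext γ
  simp only [covDeriv, vecDeriv, connectionMatrix, Pi.add_apply, Matrix.sum_mulVec,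
    Finset.sum_apply, Matrix.smul_mulVec, Pi.smul_apply, smul_eq_mul, Matrix.mulVec, dotProduct,
    christoffelMatrix, Matrix.of_apply, mapDeriv, Finset.mul_sum]
  congr 1
  exact Finset.sum_congr rfl fun a _ => Finset.sum_congr rfl fun b _ => by ring

/-- A smooth map between open sets of coordinate spaces. -/
structure IsCoordMap (u : Coord m → Coord n) (Ω : Set (Coord m)) (Ω' : Set (Coord n)) : Prop where
  isOpen : IsOpen Ω
  smooth : ContDiffOn ℝ ∞ u Ω
  mapsTo : Set.MapsTo u Ω Ω'

namespace IsCoordMap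

variable (hu : IsCoordMap u Ω Ω')
include hu

theorem smooth_apply : VecSmoothOn (fun x γ => u x γ) Ω := fun γ =>
  (EuclideanSpace.proj (𝕜 := ℝ) γ).contDiff.comp_contDiffOn hu.smooth

theorem smooth_mapDeriv (i : Fin m) : VecSmoothOn (mapDeriv u i) Ω := fun γ =>
  contDiffOn_pderiv hu.isOpen i (hu.smooth_apply γ)

theorem diff (hx : x ∈ Ω) : DifferentiableAt ℝ u x :=
  differentiableAt_of_contDiffOn hu.isOpen hu.smooth hx

theorem smooth_christoffel (hH : IsCoordMetric H Ω') (k i j : Fin n) :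
    ContDiffOn ℝ ∞ (fun z => christoffel H k i j (u z)) Ω :=
  (hH.smooth_christoffel k i j).comp hu.smooth hu.mapsTo

theorem smooth_metric (hH : IsCoordMetric H Ω') : MatSmoothOn (fun z => H (u z)) Ω :=
  fun k l => (hH.smooth k l).comp hu.smooth hu.mapsTo

theorem smooth_covDeriv (hH : IsCoordMetric H Ω') (i : Fin m) {V : Coord m → Fin n → ℝ}
    (hV : VecSmoothOn V Ω) : VecSmoothOn (covDeriv H u i V) Ω := fun γ =>
  (contDiffOn_pderiv hu.isOpen i (hV γ)).add <| ContDiffOn.sum fun α _ =>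
    ContDiffOn.sum fun β _ => ((hu.smooth_christoffel hH γ α β).mul
      (hu.smooth_mapDeriv i α)).mul (hV β)

theorem smooth_hessMap {G : Coord m → Matrix (Fin m) (Fin m) ℝ} (hG : IsCoordMetric G Ω)
    (hH : IsCoordMetric H Ω') (i j : Fin m) : VecSmoothOn (hessMap G H u i j) Ω := fun γ =>
  ((contDiffOn_pderiv hu.isOpen i (hu.smooth_mapDeriv j γ)).sub
    (ContDiffOn.sum fun k _ => (hG.smooth_christoffel k i j).mul (hu.smooth_mapDeriv k γ))).add
    (ContDiffOn.sum fun α _ => ContDiffOn.sum fun β _ => ((hu.smooth_christoffel hH γ α β).mul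
      (hu.smooth_mapDeriv i α)).mul (hu.smooth_mapDeriv j β))

theorem smooth_tension {G : Coord m → Matrix (Fin m) (Fin m) ℝ} (hG : IsCoordMetric G Ω)
    (hH : IsCoordMetric H Ω') : VecSmoothOn (tension G H u) Ω := fun γ =>
  ContDiffOn.sum fun i _ => ContDiffOn.sum fun j _ =>
    (hG.smooth.inv hG.det_ne i j).mul (hu.smooth_hessMap hG hH i j γ)

theorem matDeriv_metric (hH : IsCoordMetric H Ω') (hx : x ∈ Ω) (i : Fin m) :
    matDeriv i (fun z => H (u z)) x = (connectionMatrix H u i x)ᵀ * H (u x)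
      + H (u x) * connectionMatrix H u i x := by
  have h : matDeriv i (fun z => H (u z)) x
      = ∑ α, mapDeriv u i x α • matDeriv α H (u x) := by
    ext a b
    simp only [matDeriv, Matrix.of_apply, Matrix.sum_apply, Matrix.smul_apply, smul_eq_mul]
    exact pderiv_comp i (hH.diff (hu.mapsTo hx) a b) (hu.diff hx)
  rw [h, connectionMatrix, Matrix.transpose_sum, Matrix.sum_mul, Matrix.mul_sum,
    ← Finset.sum_add_distrib]
  refine Finset.sum_congr rfl fun α _ => ?_
  rw [hH.matDeriv_eq (hu.mapsTo hx), Matrix.transpose_smul, smul_add, Matrix.smul_mul,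
    Matrix.mul_smul]

/-- The pull-back connection is metric. -/
theorem pderiv_ip (hH : IsCoordMetric H Ω') (hx : x ∈ Ω) (i : Fin m) {V W : Coord m → Fin n → ℝ}
    (hV : VecSmoothOn V Ω) (hW : VecSmoothOn W Ω) :
    pderiv i (fun z => ip (H (u z)) (V z) (W z)) x
      = ip (H (u x)) (covDeriv H u i V x) (W x) + ip (H (u x)) (V x) (covDeriv H u i W x) := by
  have d {f : Coord m → ℝ} (hf : ContDiffOn ℝ ∞ f Ω) : DifferentiableAt ℝ f x :=
    differentiableAt_of_contDiffOn hu.isOpen hf hx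
  have hHu := hu.smooth_metric hH
  rw [covDeriv_eq, covDeriv_eq, map_add, map_add, LinearMap.add_apply, ip_mulVec_left,
    ip_mulVec_right]
  simp only [ip_eq]
  rw [pderiv_dotProduct i (fun k => d (hV k)) (fun k => d (hHu.mulVec hW k)),
    vecDeriv_mulVec i (fun k l => d (hHu k l)) (fun k => d (hW k)),
    hu.matDeriv_metric hH hx, Matrix.add_mulVec, dotProduct_add, dotProduct_add]
  ring

end IsCoordMap

theorem covDeriv_mapDeriv (G : Coord m → Matrix (Fin m) (Fin m) ℝ) (i j : Fin m) :
    covDeriv H u i (mapDeriv u j) x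
      = hessMap G H u i j x + ∑ k, christoffel G k i j x • mapDeriv u k x := by
  ext γ
  simp only [covDeriv, hessMap, mapDeriv, Pi.add_apply, Finset.sum_apply, Pi.smul_apply,
    smul_eq_mul]
  change pderiv i (pderiv j fun z => u z γ) x + _ = _
  ring

theorem bitension_eq (G : Coord m → Matrix (Fin m) (Fin m) ℝ) :
    bitension G H u x = ∑ i, ∑ j, (G x)⁻¹ i j •
      (covDeriv H u i (covDeriv H u j (tension G H u)) x
        - ∑ k, christoffel G k i j x • covDeriv H u k (tension G H u) x
        - curvatureOp H (u x) (mapDeriv u i x) (tension G H u x) *ᵥ mapDeriv u j x) := by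
  ext γ
  simp only [bitension, Finset.sum_apply, Pi.smul_apply, Pi.sub_apply, smul_eq_mul]
  refine Finset.sum_congr rfl fun i _ => Finset.sum_congr rfl fun j _ => ?_
  congr 2
  simp only [curvatureOp, Matrix.sum_mulVec, Finset.sum_apply, Matrix.smul_mulVec, Pi.smul_apply,
    smul_eq_mul]
  simp only [Matrix.mulVec, dotProduct, curvatureMatrix, Matrix.of_apply, mapDeriv,
    Finset.mul_sum]
  exact Finset.sum_congr rfl fun a _ => Finset.sum_congr rfl fun b _ =>
    Finset.sum_congr rfl fun c _ => by ring

theorem tension_eq (G : Coord m → Matrix (Fin m) (Fin m) ℝ) :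
    tension G H u x = ∑ i, ∑ j, (G x)⁻¹ i j • hessMap G H u i j x := by
  ext γ
  simp [tension]

end AlongMap

/-! ### Expansions and traces in a frame that need not be orthonormal. -/

section Frames

open scoped Matrix

variable {n : ℕ} {κ : Type*} [Fintype κ] [DecidableEq κ] {B : Matrix (Fin n) (Fin n) ℝ}
  {f : κ → Fin n → ℝ} {D : Matrix κ κ ℝ}

/-- With F the matrix whose rows are the frame, the Gram matrix is FBFᵀ, so DFB is a left inverse of
Fᵀ. Since the frame has n members, it is also a right inverse. -/
theorem frame_mul_eq_one (hκ : Fintype.card κ = n)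
    (hD : D * Matrix.of (fun a b => ip B (f a) (f b)) = 1) :
    (Matrix.of f)ᵀ * (D * Matrix.of f * B) = 1 := by
  have h : D * Matrix.of f * B * (Matrix.of f)ᵀ = 1 := by
    rw [← hD, Matrix.mul_assoc, Matrix.mul_assoc]
    congr 1
    ext a b
    rw [← Matrix.mul_assoc, Matrix.mul_assoc, Matrix.of_apply, ip_eq]
    rfl
  exact (Matrix.mul_eq_one_comm_of_card_eq _ _ _ (by simpa using hκ)).1 h

theorem frame_expansion (hκ : Fintype.card κ = n)
    (hD : D * Matrix.of (fun a b => ip B (f a) (f b)) = 1) (V : Fin n → ℝ) :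
    V = ∑ a, ∑ b, (D a b * ip B (f b) V) • f a := by
  have h := congrArg (· *ᵥ V) (frame_mul_eq_one hκ hD)
  simp only [Matrix.one_mulVec] at h
  conv_lhs => rw [← h]
  rw [← Matrix.mulVec_mulVec, ← Matrix.mulVec_mulVec, ← Matrix.mulVec_mulVec]
  ext k
  simp only [Matrix.mulVec, dotProduct, Matrix.transpose_apply, Matrix.of_apply, Finset.sum_apply,
    Pi.smul_apply, smul_eq_mul, ip_eq, Finset.mul_sum, Finset.sum_mul]
  exact Finset.sum_congr rfl fun a _ => Finset.sum_congr rfl fun b _ =>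
    Finset.sum_congr rfl fun c _ => Finset.sum_congr rfl fun d _ => by ring

/-- Insert the identity of `frame_mul_eq_one` after L and use cyclicity of the trace. -/
theorem trace_eq_sum_frame (hκ : Fintype.card κ = n)
    (hD : D * Matrix.of (fun a b => ip B (f a) (f b)) = 1) (L : Matrix (Fin n) (Fin n) ℝ) :
    L.trace = ∑ a, ∑ b, D a b * ip B (f b) (L *ᵥ f a) := by
  have h : L.trace = (D * (Matrix.of f * (B * (L * (Matrix.of f)ᵀ)))).trace := by
    conv_lhs => rw [← Matrix.mul_one L, ← frame_mul_eq_one hκ hD, ← Matrix.mul_assoc,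
      Matrix.trace_mul_comm]
    simp only [Matrix.mul_assoc]
  rw [h]
  simp only [Matrix.trace, Matrix.diag_apply, Matrix.mul_apply (M := D), ip_eq]
  rfl

end Frames

/-! ### The Ricci tensor as a trace of the curvature operator. -/

section Ricci

open scoped Matrix

variable {n : ℕ} {G : Coord n → Matrix (Fin n) (Fin n) ℝ} {x : Coord n}

/-- The matrix of the endomorphism `X ↦ R(X, Y)Z`. -/
noncomputable def ricciEnd (G : Coord n → Matrix (Fin n) (Fin n) ℝ) (x : Coord n)
    (Y Z : Fin n → ℝ) : Matrix (Fin n) (Fin n) ℝ :=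
  Matrix.of fun l i => ∑ j, ∑ k, curvature G l i j k x * Y j * Z k

theorem ricciEnd_mulVec (X Y Z : Fin n → ℝ) :
    ricciEnd G x Y Z *ᵥ X = curvatureOp G x X Y *ᵥ Z := by
  ext l
  simp only [curvatureOp, Matrix.sum_mulVec, Finset.sum_apply, Matrix.smul_mulVec, Pi.smul_apply,
    smul_eq_mul]
  simp only [Matrix.mulVec, dotProduct, curvatureMatrix, ricciEnd, Matrix.of_apply,
    Finset.mul_sum, Finset.sum_mul]
  exact Finset.sum_congr rfl fun a _ => Finset.sum_congr rfl fun b _ =>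
    Finset.sum_congr rfl fun c _ => by ring

theorem trace_ricciEnd (Y Z : Fin n → ℝ) : (ricciEnd G x Y Z).trace = ip (ricci G x) Y Z := by
  rw [ip_eq_sum]
  simp only [Matrix.trace, Matrix.diag_apply, ricciEnd, ricci, Matrix.of_apply, Finset.sum_mul]
  rw [Finset.sum_comm]
  refine Finset.sum_congr rfl fun a _ => ?_
  rw [Finset.sum_comm]

end Ricci

/-! ### Umbilical hypersurfaces in coordinates. -/

section Hypersurface

open scoped Matrix Topology

variable {m : ℕ} {x : Coord m} {Ω : Set (Coord m)} {Ω' : Set (Coord (m + 1))}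
  {G : Coord m → Matrix (Fin m) (Fin m) ℝ}
  {H : Coord (m + 1) → Matrix (Fin (m + 1)) (Fin (m + 1)) ℝ} {u : Coord m → Coord (m + 1)}

/-- `ν` is a unit normal vector at `x` and the shape operator with respect to `ν` is `c` times the
identity. -/
structure IsUmbilicAt (G : Coord m → Matrix (Fin m) (Fin m) ℝ)
    (H : Coord (m + 1) → Matrix (Fin (m + 1)) (Fin (m + 1)) ℝ) (u : Coord m → Coord (m + 1))
    (x : Coord m) (ν : Fin (m + 1) → ℝ) (c : ℝ) : Prop where
  normal : ∀ i, ip (H (u x)) ν (mapDeriv u i x) = 0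
  unit : ip (H (u x)) ν ν = 1
  second : ∀ i j, ip (H (u x)) (hessMap G H u i j x) ν = c * G x i j

/-- An isometrically immersed totally umbilical hypersurface in coordinates. -/
structure IsUmbilicalHypersurface (G : Coord m → Matrix (Fin m) (Fin m) ℝ)
    (H : Coord (m + 1) → Matrix (Fin (m + 1)) (Fin (m + 1)) ℝ) (u : Coord m → Coord (m + 1))
    (Ω : Set (Coord m)) (Ω' : Set (Coord (m + 1))) : Prop where
  source : IsCoordMetric G Ω
  target : IsCoordMetric H Ω'
  map : IsCoordMap u Ω Ω'
  isometric : ∀ x ∈ Ω, ∀ i j, ip (H (u x)) (mapDeriv u i x) (mapDeriv u j x) = G x i j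
  umbilical : ∀ x ∈ Ω, ∃ ν c, IsUmbilicAt G H u x ν c

/-- The frame du(∂₁), …, du(∂ₘ), ν has Gram matrix diag(G, 1), whose inverse is explicit, so no
orthonormalization is needed. -/
theorem IsUmbilicAt.frame (hG : IsCoordMetric G Ω) (hx : x ∈ Ω) {ν : Fin (m + 1) → ℝ} {c : ℝ}
    (hν : IsUmbilicAt G H u x ν c) (hB : (H (u x)).IsSymm)
    (hiso : ∀ i j, ip (H (u x)) (mapDeriv u i x) (mapDeriv u j x) = G x i j) :
    Matrix.fromBlocks (G x)⁻¹ 0 0 (1 : Matrix Unit Unit ℝ)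
      * Matrix.of (fun a b => ip (H (u x)) (Sum.elim (fun i => mapDeriv u i x) (fun _ => ν) a)
        (Sum.elim (fun i => mapDeriv u i x) (fun _ => ν) b)) = 1 := by
  have h : Matrix.of (fun a b => ip (H (u x)) (Sum.elim (fun i => mapDeriv u i x) (fun _ => ν) a)
        (Sum.elim (fun i => mapDeriv u i x) (fun _ => ν) b))
      = Matrix.fromBlocks (G x) 0 0 (1 : Matrix Unit Unit ℝ) := by
    ext a b
    rcases a with a | a <;> rcases b with b | b
    · simpa using hiso a b
    · rw [Matrix.of_apply, ip_comm hB]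
      simpa using hν.normal a
    · simpa using hν.normal b
    · simpa using hν.unit
  rw [h, Matrix.fromBlocks_multiply]
  simp [hG.inv_mul hx]

namespace IsUmbilicalHypersurface

variable (hS : IsUmbilicalHypersurface G H u Ω Ω')
include hS

theorem symm (hx : x ∈ Ω) : (H (u x)).IsSymm := hS.target.symm _ (hS.map.mapsTo hx)

theorem expansion (hx : x ∈ Ω) {ν : Fin (m + 1) → ℝ} {c : ℝ} (hν : IsUmbilicAt G H u x ν c)
    (V : Fin (m + 1) → ℝ) :
    V = ∑ i, ∑ j, ((G x)⁻¹ i j * ip (H (u x)) (mapDeriv u j x) V) • mapDeriv u i x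
      + ip (H (u x)) ν V • ν := by
  have h := frame_expansion (by simp) (hν.frame hS.source hx (hS.symm hx) (hS.isometric x hx)) V
  simpa [Fintype.sum_sum_type] using h

/-- Compute Ric(aν, Z) as the trace of X ↦ R(X, aν)Z in the frame du(∂ᵢ), ν. The ν term is R(ν, aν)
= 0, and moving Z out of the curvature operator by skew-symmetry produces the minus sign. -/
theorem ricci_eq (hx : x ∈ Ω) {ν : Fin (m + 1) → ℝ} {c : ℝ} (hν : IsUmbilicAt G H u x ν c)
    (a : ℝ) (Z : Fin (m + 1) → ℝ) :
    ∑ i, ∑ j, (G x)⁻¹ i j *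
        ip (H (u x)) (curvatureOp H (u x) (mapDeriv u i x) (a • ν) *ᵥ mapDeriv u j x) Z
      = -ip (ricci H (u x)) (a • ν) Z := by
  have h := trace_eq_sum_frame (by simp)
    (hν.frame hS.source hx (hS.symm hx) (hS.isometric x hx)) (ricciEnd H (u x) (a • ν) Z)
  rw [trace_ricciEnd] at h
  simp only [ricciEnd_mulVec, Fintype.sum_sum_type, Sum.elim_inl, Sum.elim_inr,
    Matrix.fromBlocks_apply₁₁, Matrix.fromBlocks_apply₁₂, Matrix.fromBlocks_apply₂₁,
    Matrix.fromBlocks_apply₂₂, curvatureOp_self_smul, Matrix.zero_mulVec, map_zero,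
    Matrix.zero_apply, zero_mul, mul_zero, Finset.sum_const_zero, add_zero] at h
  rw [h, ← Finset.sum_neg_distrib]
  refine Finset.sum_congr rfl fun i _ => ?_
  rw [← Finset.sum_neg_distrib]
  refine Finset.sum_congr rfl fun j _ => ?_
  rw [hS.target.ip_curvatureOp (hS.map.mapsTo hx), ip_comm (hS.symm hx) (mapDeriv u j x)]
  ring

theorem hessMap_symm (hx : x ∈ Ω) (i j : Fin m) : hessMap G H u i j x = hessMap G H u j i x := by
  ext γ
  rw [hessMap, hessMap, pderiv_comm i j
    ((hS.map.smooth_apply γ).contDiffAt (hS.source.isOpen.mem_nhds hx))]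
  congr 1
  · congr 1
    exact Finset.sum_congr rfl fun k _ => by rw [hS.source.christoffel_symm hx]
  · rw [Finset.sum_comm]
    refine Finset.sum_congr rfl fun a _ => Finset.sum_congr rfl fun b _ => ?_
    rw [hS.target.christoffel_symm (hS.map.mapsTo hx) γ a b]
    ring

theorem pderiv_metric (hx : x ∈ Ω) (k i j : Fin m) :
    pderiv k (fun z => G z i j) x = ∑ s, christoffel G s k i x * G x s j
      + ∑ s, christoffel G s k j x * G x i s := by
  have h := congrFun (congrFun (hS.source.matDeriv_eq hx k) i) j
  simp only [matDeriv, Matrix.of_apply, Matrix.add_apply, Matrix.mul_apply,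
    Matrix.transpose_apply, christoffelMatrix] at h
  rw [h]
  congr 1
  exact Finset.sum_congr rfl fun s _ => mul_comm _ _

/-- The second fundamental form of an isometric immersion is normal. -/
theorem hessMap_normal (hx : x ∈ Ω) (i j k : Fin m) :
    ip (H (u x)) (hessMap G H u i j x) (mapDeriv u k x) = 0 := by
  set S : Fin m → Fin m → Fin m → ℝ := fun i j k =>
    ip (H (u x)) (hessMap G H u i j x) (mapDeriv u k x) with hSdef
  have h1 (i j k) : S i j k = S j i k := by simp only [hSdef, hS.hessMap_symm hx i j]
  have h2 (k i j) : S k i j = -S k j i := by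
    have h := hS.map.pderiv_ip hS.target hx k (hS.map.smooth_mapDeriv i) (hS.map.smooth_mapDeriv j)
    have h' : pderiv k (fun z => ip (H (u z)) (mapDeriv u i z) (mapDeriv u j z)) x
        = pderiv k (fun z => G z i j) x := by
      refine pderiv_congr k ?_
      filter_upwards [hS.source.isOpen.mem_nhds hx] with z hz
      exact hS.isometric z hz i j
    rw [h', hS.pderiv_metric hx, covDeriv_mapDeriv G, covDeriv_mapDeriv G] at h
    simp only [map_add, map_sum, LinearMap.add_apply, LinearMap.sum_apply, map_smul,
      LinearMap.smul_apply, smul_eq_mul, hS.isometric x hx] at h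
    rw [ip_comm (hS.symm hx) (mapDeriv u i x)] at h
    simp only [hSdef]
    linarith
  change S i j k = 0
  -- A trilinear symbol symmetric in its first two slots and skew in its last two is zero.
  linarith [h1 i j k, h1 j k i, h1 k i j, h2 i j k, h2 j k i, h2 k i j]

theorem hessMap_eq (hx : x ∈ Ω) {ν : Fin (m + 1) → ℝ} {c : ℝ} (hν : IsUmbilicAt G H u x ν c)
    (i j : Fin m) : hessMap G H u i j x = (c * G x i j) • ν := by
  have h := hS.expansion hx hν (hessMap G H u i j x)
  simp only [ip_comm (hS.symm hx) _ (hessMap G H u i j x), hS.hessMap_normal hx, hν.second,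
    mul_zero, zero_smul, Finset.sum_const_zero, zero_add] at h
  exact h

theorem sum_inv_mul_metric (hx : x ∈ Ω) : ∑ i, ∑ j, (G x)⁻¹ i j * G x i j = m := by
  have h := congrArg Matrix.trace (hS.source.inv_mul hx)
  rw [Matrix.trace_one, Fintype.card_fin] at h
  simp only [Matrix.trace, Matrix.diag_apply, Matrix.mul_apply] at h
  rw [← h]
  exact Finset.sum_congr rfl fun i _ => Finset.sum_congr rfl fun j _ => by
    rw [(hS.source.symm x hx).apply]

theorem tension_eq_smul (hx : x ∈ Ω) {ν : Fin (m + 1) → ℝ} {c : ℝ}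
    (hν : IsUmbilicAt G H u x ν c) : tension G H u x = (m * c) • ν := by
  rw [tension_eq, ← hS.sum_inv_mul_metric hx, Finset.sum_mul, Finset.sum_smul]
  refine Finset.sum_congr rfl fun i _ => ?_
  rw [Finset.sum_mul, Finset.sum_smul]
  refine Finset.sum_congr rfl fun j _ => ?_
  rw [hS.hessMap_eq hx hν, smul_smul]
  congr 1
  ring

/-- This eliminates ν and c, which may vary irregularly, in favour of the smooth field τ, so that
later identities can be differentiated. -/
theorem hessMap_eq_tension (hx : x ∈ Ω) (i j : Fin m) :
    hessMap G H u i j x = ((1 / (m : ℝ)) * G x i j) • tension G H u x := by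
  obtain ⟨ν, c, hν⟩ := hS.umbilical x hx
  have hm : (m : ℝ) ≠ 0 := by
    have := i.pos
    positivity
  rw [hS.hessMap_eq hx hν, hS.tension_eq_smul hx hν, smul_smul]
  congr 1
  field_simp

theorem tension_normal (hx : x ∈ Ω) (k : Fin m) :
    ip (H (u x)) (tension G H u x) (mapDeriv u k x) = 0 := by
  obtain ⟨ν, c, hν⟩ := hS.umbilical x hx
  rw [hS.tension_eq_smul hx hν, map_smul, LinearMap.smul_apply, hν.normal, smul_zero]

theorem norm_sq_tension (hx : x ∈ Ω) {ν : Fin (m + 1) → ℝ} {c : ℝ}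
    (hν : IsUmbilicAt G H u x ν c) :
    ip (H (u x)) (tension G H u x) (tension G H u x) = (m * c) ^ 2 := by
  rw [hS.tension_eq_smul hx hν, LinearMap.map_smul₂, map_smul, hν.unit]
  simp [sq]

end IsUmbilicalHypersurface

end Hypersurface

/-! ### Tangential and normal parts of the biharmonic equation. -/

section LocalTheorem

open scoped Matrix Topology

variable {m : ℕ} {x : Coord m} {Ω : Set (Coord m)} {Ω' : Set (Coord (m + 1))}
  {G : Coord m → Matrix (Fin m) (Fin m) ℝ}
  {H : Coord (m + 1) → Matrix (Fin (m + 1)) (Fin (m + 1)) ℝ} {u : Coord m → Coord (m + 1)}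

theorem covDeriv_eq_zero {V : Coord m → Fin (m + 1) → ℝ} (hΩ : IsOpen Ω)
    (hV : ∀ z ∈ Ω, V z = 0) (i : Fin m) (hx : x ∈ Ω) : covDeriv H u i V x = 0 := by
  rw [covDeriv_eq, hV x hx, Matrix.mulVec_zero, add_zero]
  ext γ
  rw [vecDeriv, pderiv_congr (f₂ := fun _ => 0) i, pderiv_const, Pi.zero_apply]
  filter_upwards [hΩ.mem_nhds hx] with z hz
  rw [hV z hz, Pi.zero_apply]

theorem bitension_eq_zero_of_tension_eq_zero (hΩ : IsOpen Ω)
    (hT : ∀ z ∈ Ω, tension G H u z = 0) (hx : x ∈ Ω) : bitension G H u x = 0 := by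
  have h1 (i : Fin m) (z) (hz : z ∈ Ω) : covDeriv H u i (tension G H u) z = 0 :=
    covDeriv_eq_zero hΩ hT i hz
  have h2 (i j : Fin m) : covDeriv H u i (covDeriv H u j (tension G H u)) x = 0 :=
    covDeriv_eq_zero hΩ (h1 j) i hx
  rw [bitension_eq]
  simp [h1 _ x hx, h2, hT x hx, curvatureOp]

/-- The squared norm of the tension field. -/
noncomputable def tensionSq (G : Coord m → Matrix (Fin m) (Fin m) ℝ)
    (H : Coord (m + 1) → Matrix (Fin (m + 1)) (Fin (m + 1)) ℝ) (u : Coord m → Coord (m + 1))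
    (x : Coord m) : ℝ :=
  ip (H (u x)) (tension G H u x) (tension G H u x)

theorem IsCoordMap.contDiffOn_ip (hu : IsCoordMap u Ω Ω') (hH : IsCoordMetric H Ω')
    {V W : Coord m → Fin (m + 1) → ℝ} (hV : VecSmoothOn V Ω) (hW : VecSmoothOn W Ω) :
    ContDiffOn ℝ ∞ (fun z => ip (H (u z)) (V z) (W z)) Ω := by
  simp only [ip_eq]
  exact hV.dotProduct ((hu.smooth_metric hH).mulVec hW)

theorem IsCoordMetric.sum_inv_mul (hG : IsCoordMetric G Ω) (hx : x ∈ Ω) (b : Fin m → ℝ)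
    (l : Fin m) : ∑ i, ∑ j, (G x)⁻¹ i j * (G x j l * b i) = b l := by
  have h := congrArg (b ᵥ* ·) (hG.inv_mul hx)
  simp only [Matrix.vecMul_one] at h
  conv_rhs => rw [← h]
  simp only [Matrix.vecMul, dotProduct, Matrix.mul_apply, Finset.mul_sum]
  exact Finset.sum_congr rfl fun i _ => Finset.sum_congr rfl fun j _ => by ring

theorem IsCoordMetric.sum_inv_mul' (hG : IsCoordMetric G Ω) (hx : x ∈ Ω) (b : Fin m → ℝ)
    (l : Fin m) : ∑ i, ∑ j, (G x)⁻¹ i j * (G x i l * b j) = b l := by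
  rw [Finset.sum_comm]
  conv_rhs => rw [← hG.sum_inv_mul hx b l]
  exact Finset.sum_congr rfl fun i _ => Finset.sum_congr rfl fun j _ => by
    rw [(hG.inv_symm hx).apply]

namespace IsUmbilicalHypersurface

variable (hS : IsUmbilicalHypersurface G H u Ω Ω')
include hS

theorem smooth_tension : VecSmoothOn (tension G H u) Ω :=
  hS.map.smooth_tension hS.source hS.target

theorem smooth_covDeriv_tension (i : Fin m) : VecSmoothOn (covDeriv H u i (tension G H u)) Ω :=
  hS.map.smooth_covDeriv hS.target i hS.smooth_tension

theorem contDiffOn_tensionSq : ContDiffOn ℝ ∞ (tensionSq G H u) Ω :=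
  hS.map.contDiffOn_ip hS.target hS.smooth_tension hS.smooth_tension

theorem pderiv_tensionSq (hx : x ∈ Ω) (i : Fin m) :
    pderiv i (tensionSq G H u) x
      = 2 * ip (H (u x)) (covDeriv H u i (tension G H u) x) (tension G H u x) := by
  have h := hS.map.pderiv_ip hS.target hx i hS.smooth_tension hS.smooth_tension
  rw [ip_comm (hS.symm hx) (tension G H u x)] at h
  rw [two_mul]
  exact h

/-- Differentiate ⟨τ, du(∂ⱼ)⟩ = 0. The Christoffel part of ∇ᵢdu(∂ⱼ) is tangential and drops out; the
rest is (1/m) gᵢⱼ τ. -/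
theorem covDeriv_tension_tangent (hx : x ∈ Ω) (i j : Fin m) :
    ip (H (u x)) (covDeriv H u i (tension G H u) x) (mapDeriv u j x)
      = -(1 / (m : ℝ)) * (G x i j * tensionSq G H u x) := by
  have h := hS.map.pderiv_ip hS.target hx i hS.smooth_tension (hS.map.smooth_mapDeriv j)
  rw [pderiv_congr (f₂ := fun _ => 0) i, pderiv_const, covDeriv_mapDeriv G] at h
  · simp only [map_add, map_sum, map_smul, hS.tension_normal hx, mul_zero,
      Finset.sum_const_zero, add_zero, hS.hessMap_eq_tension hx, smul_eq_mul] at h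
    rw [tensionSq]
    linarith
  · filter_upwards [hS.source.isOpen.mem_nhds hx] with z hz
    exact hS.tension_normal hz j

/-- Differentiate `covDeriv_tension_tangent`. The Christoffel sums from ∂ᵢgⱼₗ are absorbed by those
on the left and in ∇ᵢdu(∂ₗ). The factor 1/2 comes from ⟨∇ⱼτ, ∇dφ(∂ᵢ, ∂ₗ)⟩ = (1/m) gᵢₗ⟨∇ⱼτ, τ⟩, with
⟨∇ⱼτ, τ⟩ = ∂ⱼρ/2. -/
theorem covDeriv_covDeriv_tension_tangent (hx : x ∈ Ω) (i j l : Fin m) :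
    ip (H (u x)) (covDeriv H u i (covDeriv H u j (tension G H u)) x) (mapDeriv u l x)
        - ∑ k, christoffel G k i j x
          * ip (H (u x)) (covDeriv H u k (tension G H u) x) (mapDeriv u l x)
      = -(1 / (m : ℝ)) * (G x j l * pderiv i (tensionSq G H u) x
        + 1 / 2 * (G x i l * pderiv j (tensionSq G H u) x)) := by
  have d {f : Coord m → ℝ} (hf : ContDiffOn ℝ ∞ f Ω) : DifferentiableAt ℝ f x :=
    differentiableAt_of_contDiffOn hS.source.isOpen hf hx
  have h := hS.map.pderiv_ip hS.target hx i (hS.smooth_covDeriv_tension j)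
    (hS.map.smooth_mapDeriv l)
  rw [pderiv_congr (f₂ := fun z => -(1 / (m : ℝ)) * (G z j l * tensionSq G H u z)) i,
    pderiv_const_mul, pderiv_mul i (hS.source.diff hx j l) (d hS.contDiffOn_tensionSq),
    hS.pderiv_metric hx, covDeriv_mapDeriv G] at h
  · simp only [map_add, map_sum, map_smul, hS.hessMap_eq_tension hx, smul_eq_mul,
      hS.covDeriv_tension_tangent hx] at h
    have hρ := hS.pderiv_tensionSq hx j
    simp only [hS.covDeriv_tension_tangent hx]
    have e1 : ∑ k, christoffel G k i j x * (-(1 / (m : ℝ)) * (G x k l * tensionSq G H u x))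
        = -(1 / (m : ℝ)) * tensionSq G H u x * ∑ s, christoffel G s i j x * G x s l := by
      rw [Finset.mul_sum]
      exact Finset.sum_congr rfl fun _ _ => by ring
    have e2 : ∑ k, christoffel G k i l x * (-(1 / (m : ℝ)) * (G x j k * tensionSq G H u x))
        = -(1 / (m : ℝ)) * tensionSq G H u x * ∑ s, christoffel G s i l x * G x j s := by
      rw [Finset.mul_sum]
      exact Finset.sum_congr rfl fun _ _ => by ring
    rw [e2] at h
    rw [e1, hρ]
    linear_combination -h
  · exact (hS.source.diff hx j l).mul (d hS.contDiffOn_tensionSq)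
  · filter_upwards [hS.source.isOpen.mem_nhds hx] with z hz
    exact hS.covDeriv_tension_tangent hz j l

/-- The Einstein condition turns the curvature trace into a multiple of τ. Leaving Z free lets one
formula serve both parts: Z = du(∂ₗ) for the tangential and Z = τ for the normal one. -/
theorem ip_bitension (hx : x ∈ Ω) {κ : ℝ} (hE : ricci H (u x) = κ • H (u x))
    (Z : Fin (m + 1) → ℝ) :
    ip (H (u x)) (bitension G H u x) Z
      = ∑ i, ∑ j, (G x)⁻¹ i j *
          (ip (H (u x)) (covDeriv H u i (covDeriv H u j (tension G H u)) x) Z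
            - ∑ k, christoffel G k i j x
              * ip (H (u x)) (covDeriv H u k (tension G H u) x) Z)
        + κ * ip (H (u x)) (tension G H u x) Z := by
  obtain ⟨ν, c, hν⟩ := hS.umbilical x hx
  have hR := hS.ricci_eq hx hν (m * c) Z
  rw [← hS.tension_eq_smul hx hν, hE] at hR
  have hR' : ip (κ • H (u x)) (tension G H u x) Z = κ * ip (H (u x)) (tension G H u x) Z := by
    simp [ip_eq]
  rw [hR'] at hR
  rw [bitension_eq]
  simp only [map_sum, map_sub, map_smul, LinearMap.sum_apply, LinearMap.sub_apply,
    LinearMap.smul_apply, smul_eq_mul, mul_sub, Finset.sum_sub_distrib, hR]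
  ring

theorem pderiv_tensionSq_eq_zero (hx : x ∈ Ω) {κ : ℝ} (hE : ricci H (u x) = κ • H (u x))
    (hb : bitension G H u x = 0) (l : Fin m) : pderiv l (tensionSq G H u) x = 0 := by
  have h := hS.ip_bitension hx hE (mapDeriv u l x)
  simp only [hb, map_zero, LinearMap.zero_apply, hS.tension_normal hx, mul_zero, add_zero,
    hS.covDeriv_covDeriv_tension_tangent hx] at h
  have e : ∑ i, ∑ j, (G x)⁻¹ i j * (-(1 / (m : ℝ)) * (G x j l * pderiv i (tensionSq G H u) x
        + 1 / 2 * (G x i l * pderiv j (tensionSq G H u) x)))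
      = -(1 / (m : ℝ)) * (∑ i, ∑ j, (G x)⁻¹ i j * (G x j l * pderiv i (tensionSq G H u) x)
        + 1 / 2 * ∑ i, ∑ j, (G x)⁻¹ i j * (G x i l * pderiv j (tensionSq G H u) x)) := by
    simp only [Finset.mul_sum, ← Finset.sum_add_distrib]
    exact Finset.sum_congr rfl fun _ _ => Finset.sum_congr rfl fun _ _ => by ring
  -- The two contractions add up to (1 + 1/2) ∂ₗρ, and 3/2 ≠ 0 whatever the dimension.
  rw [e, hS.source.sum_inv_mul hx (fun i => pderiv i (tensionSq G H u) x),
    hS.source.sum_inv_mul' hx (fun i => pderiv i (tensionSq G H u) x)] at h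
  have hm : (m : ℝ) ≠ 0 := by
    have := l.pos
    positivity
  field_simp at h
  linarith

/-- The component along ν is ∂ᵢρ / (2mc), which is where c ≠ 0 is needed; the tangential components
are already known. -/
theorem covDeriv_tension_eq (hx : x ∈ Ω) {ν : Fin (m + 1) → ℝ} {c : ℝ}
    (hν : IsUmbilicAt G H u x ν c) (hc : c ≠ 0) (i : Fin m)
    (hρ : pderiv i (tensionSq G H u) x = 0) :
    covDeriv H u i (tension G H u) x
      = (-(1 / (m : ℝ)) * tensionSq G H u x) • mapDeriv u i x := by
  have hm : (m : ℝ) ≠ 0 := by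
    have := i.pos
    positivity
  have hn : ip (H (u x)) ν (covDeriv H u i (tension G H u) x) = 0 := by
    have h := hS.pderiv_tensionSq hx i
    rw [hρ, hS.tension_eq_smul hx hν, map_smul, ip_comm (hS.symm hx)] at h
    simpa [hm, hc] using h.symm
  have h := hS.expansion hx hν (covDeriv H u i (tension G H u) x)
  rw [hn, zero_smul, add_zero] at h
  rw [h]
  ext γ
  simp only [Finset.sum_apply, Pi.smul_apply, smul_eq_mul]
  rw [← hS.source.sum_inv_mul hx (fun k => mapDeriv u k x γ) i, Finset.mul_sum]
  refine Finset.sum_congr rfl fun a _ => ?_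
  rw [Finset.mul_sum]
  refine Finset.sum_congr rfl fun b _ => ?_
  rw [ip_comm (hS.symm hx), hS.covDeriv_tension_tangent hx, (hS.source.symm x hx).apply]
  ring

/-- The normal part of the equation of biharmonic maps. -/
theorem factor_eq_zero_or (hx : x ∈ Ω) {κ : ℝ} (hE : ricci H (u x) = κ • H (u x))
    (hb : bitension G H u x = 0) (hρ : ∀ z ∈ Ω, ∀ i, pderiv i (tensionSq G H u) z = 0)
    {ν : Fin (m + 1) → ℝ} {c : ℝ} (hν : IsUmbilicAt G H u x ν c) (hm : 1 ≤ m) :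
    c = 0 ∨ m * c ^ 2 = κ := by
  by_cases hc : c = 0
  · exact Or.inl hc
  right
  -- This must hold on all of Ω, as it is differentiated in `h2`; c ≠ 0 is known only at x.
  have hzero (z) (hz : z ∈ Ω) (j : Fin m) :
      ip (H (u z)) (covDeriv H u j (tension G H u) z) (tension G H u z) = 0 := by
    have h := hS.pderiv_tensionSq hz j
    rw [hρ z hz] at h
    linarith
  -- ⟨∇ᵢ∇ⱼτ, τ⟩ = -⟨∇ⱼτ, ∇ᵢτ⟩, and both factors are -(ρ/m) times coordinate tangent vectors.
  have h2 (i j : Fin m) :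
      ip (H (u x)) (covDeriv H u i (covDeriv H u j (tension G H u)) x) (tension G H u x)
        = -(1 / (m : ℝ) * tensionSq G H u x) ^ 2 * G x i j := by
    have h := hS.map.pderiv_ip hS.target hx i (hS.smooth_covDeriv_tension j) hS.smooth_tension
    rw [pderiv_congr (f₂ := fun _ => 0) i, pderiv_const,
      hS.covDeriv_tension_eq hx hν hc i (hρ x hx i), hS.covDeriv_tension_eq hx hν hc j (hρ x hx j),
      map_smul, LinearMap.map_smul₂, hS.isometric x hx, (hS.source.symm x hx).apply] at h
    · simp only [smul_eq_mul] at h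
      linear_combination -h
    · filter_upwards [hS.source.isOpen.mem_nhds hx] with z hz
      exact hzero z hz j
  have h := hS.ip_bitension hx hE (tension G H u x)
  have hm0 : (m : ℝ) ≠ 0 := by positivity
  simp only [hb, map_zero, LinearMap.zero_apply, h2, hzero x hx, mul_zero,
    Finset.sum_const_zero, sub_zero] at h
  have e : ∑ i, ∑ j, (G x)⁻¹ i j * (-(1 / (m : ℝ) * tensionSq G H u x) ^ 2 * G x i j)
      = -(1 / (m : ℝ) * tensionSq G H u x) ^ 2 * m := by
    rw [← hS.sum_inv_mul_metric hx, Finset.mul_sum]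
    refine Finset.sum_congr rfl fun i _ => ?_
    rw [Finset.mul_sum]
    refine Finset.sum_congr rfl fun j _ => ?_
    ring
  rw [e, tensionSq, hS.norm_sq_tension hx hν] at h
  have h' : (m * c) ^ 2 * (κ - m * c ^ 2) = 0 := by
    field_simp at h
    linear_combination -h
  have := (mul_eq_zero.1 h').resolve_left (by positivity)
  linarith

end IsUmbilicalHypersurface

end LocalTheorem

/-! ### Riemannian metrics read in charts. -/

section Charts

open scoped Matrix Topology

variable {n : ℕ} {N : Type*}
  [TopologicalSpace N] [ChartedSpace (Coord n) N] {e : OpenPartialHomeomorph N (Coord n)}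

theorem mfderiv_chart_symm (he : e ∈ IsManifold.maximalAtlas (𝓡 n) ∞ N) {x : Coord n}
    (hx : x ∈ e.target) (v : Coord n) :
    (mfderiv (𝓡 n) (𝓡 n) e (e.symm x) (mfderiv (𝓡 n) (𝓡 n) e.symm x v) : Coord n) = v := by
  have h1 : MDifferentiableAt (𝓡 n) (𝓡 n) e.symm x :=
    (contMDiffAt_symm_of_mem_maximalAtlas he hx).mdifferentiableAt (by simp)
  have h2 : MDifferentiableAt (𝓡 n) (𝓡 n) e (e.symm x) :=
    (contMDiffAt_of_mem_maximalAtlas he (e.map_target hx)).mdifferentiableAt (by simp)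
  have h3 := mfderiv_comp x h2 h1
  have h4 : mfderiv (𝓡 n) (𝓡 n) (e ∘ e.symm) x = mfderiv (𝓡 n) (𝓡 n) id x := by
    refine Filter.EventuallyEq.mfderiv_eq ?_
    filter_upwards [e.open_target.mem_nhds hx] with z hz
    exact e.right_inv hz
  rw [mfderiv_id] at h4
  exact congrArg (fun L => (L v : Coord n)) (h3.symm.trans h4)

theorem mfderiv_symm_chart (he : e ∈ IsManifold.maximalAtlas (𝓡 n) ∞ N) {q : N}
    (hq : q ∈ e.source) (v : TangentSpace (𝓡 n) q) :
    (mfderiv (𝓡 n) (𝓡 n) e.symm (e q) (vecCoord e v) : Coord n) = v := by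
  have h1 : MDifferentiableAt (𝓡 n) (𝓡 n) e.symm (e q) :=
    (contMDiffAt_symm_of_mem_maximalAtlas he (e.map_source hq)).mdifferentiableAt (by simp)
  have h2 : MDifferentiableAt (𝓡 n) (𝓡 n) e q :=
    (contMDiffAt_of_mem_maximalAtlas he hq).mdifferentiableAt (by simp)
  have h3 := mfderiv_comp q h1 h2
  have h4 : mfderiv (𝓡 n) (𝓡 n) (e.symm ∘ e) q = mfderiv (𝓡 n) (𝓡 n) id q := by
    refine Filter.EventuallyEq.mfderiv_eq ?_
    filter_upwards [e.open_source.mem_nhds hq] with z hz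
    exact e.left_inv hz
  rw [mfderiv_id] at h4
  exact congrArg (fun L => (L v : Coord n)) (h3.symm.trans h4)

variable [IsManifold (𝓡 n) ∞ N] {h : Metric n N}

theorem ip_metricCoord (x : Coord n) (v w : Fin n → ℝ) :
    ip (metricCoord h e x) v w = h.inner (e.symm x)
      (mfderiv (𝓡 n) (𝓡 n) e.symm x (WithLp.toLp 2 v : Coord n))
      (mfderiv (𝓡 n) (𝓡 n) e.symm x (WithLp.toLp 2 w : Coord n)) := by
  set b : Coord n →L[ℝ] Coord n →L[ℝ] ℝ := h.inner (e.symm x) with hb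
  set D : Coord n →L[ℝ] Coord n := mfderiv (𝓡 n) (𝓡 n) e.symm x with hD
  have hs (v : Fin n → ℝ) : (WithLp.toLp 2 v : Coord n) = ∑ i, v i • EuclideanSpace.single i 1 := by
    have := (EuclideanSpace.basisFun (Fin n) ℝ).sum_repr (WithLp.toLp 2 v)
    simpa using this.symm
  change _ = b (D (WithLp.toLp 2 v)) (D (WithLp.toLp 2 w))
  rw [hs v, hs w, ip_eq_sum]
  simp only [map_sum, map_smul, sum_apply, smul_apply,
    smul_eq_mul, Finset.mul_sum]
  rw [Finset.sum_comm]
  refine Finset.sum_congr rfl fun i _ => Finset.sum_congr rfl fun j _ => ?_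
  change b (D (EuclideanSpace.single _ 1)) (D (EuclideanSpace.single _ 1)) * _ * _ = _
  ring

theorem inner_eq_ip (he : e ∈ IsManifold.maximalAtlas (𝓡 n) ∞ N) {q : N} (hq : q ∈ e.source)
    (v w : TangentSpace (𝓡 n) q) :
    h.inner q v w = ip (metricCoord h e (e q)) (vecCoord e v) (vecCoord e w) := by
  -- The base point `e.symm (e q)` equals `q` only propositionally, so the tangent spaces are
  -- identified by substitution.
  have key (q' : N) (hq' : q' = q) (v' w' : Coord n) (hv : v' = v) (hw : w' = w) :
      h.inner q v w = h.inner q' v' w' := by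
    subst hq' hv hw
    rfl
  rw [ip_metricCoord]
  exact key _ (e.left_inv hq) _ _ (mfderiv_symm_chart he hq v) (mfderiv_symm_chart he hq w)

/-- The coordinate field is the image of a constant section under the smooth tangent map of
`e.symm`. -/
theorem contMDiffOn_mfderiv_symm (he : e ∈ IsManifold.maximalAtlas (𝓡 n) ∞ N) (v : Coord n) :
    ContMDiffOn (𝓡 n) (𝓡 n).tangent ∞ (fun x => (⟨e.symm x, mfderiv (𝓡 n) (𝓡 n) e.symm x v⟩ :
      TangentBundle (𝓡 n) N)) e.target := by
  have h1 := (contMDiffOn_symm_of_mem_maximalAtlas he).contMDiffOn_tangentMapWithin (m := ∞)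
    (by simp) e.open_target.uniqueMDiffOn
  have h2 : ContMDiff (𝓡 n) (𝓡 n).tangent ∞
      (fun x : Coord n => (⟨x, v⟩ : TangentBundle (𝓡 n) (Coord n))) := by
    intro x
    refine (Bundle.contMDiffAt_section (E := fun y : Coord n => TangentSpace (𝓡 n) y)
      (s := fun _ => v) x).2 ?_
    simpa using contMDiffAt_const
  refine (h1.comp (s := e.target) h2.contMDiffOn fun x hx => hx).congr fun x hx => ?_
  simp only [Function.comp, tangentMapWithin, mfderivWithin_of_isOpen e.open_target hx]

theorem matSmoothOn_metricCoord (he : e ∈ IsManifold.maximalAtlas (𝓡 n) ∞ N) :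
    MatSmoothOn (metricCoord h e) e.target := by
  intro i j
  rw [← contMDiffOn_iff_contDiffOn]
  have hb := contMDiffOn_symm_of_mem_maximalAtlas he
  have h1 : ContMDiffOn (𝓡 n) ((𝓡 n).prod 𝓘(ℝ)) ∞
      (fun x => Bundle.TotalSpace.mk' ℝ (E := Bundle.Trivial N ℝ) (e.symm x)
        (metricCoord h e x i j)) e.target := by
    apply ContMDiffOn.clm_bundle_apply₂ (F₁ := Coord n) (F₂ := Coord n)
    · exact h.contMDiff.comp_contMDiffOn hb
    · exact contMDiffOn_mfderiv_symm he _
    · exact contMDiffOn_mfderiv_symm he _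
  intro x hx
  have h2 := h1 x hx
  simp only [Bundle.contMDiffWithinAt_totalSpace] at h2
  exact h2.2

theorem isCoordMetric_metricCoord (he : e ∈ IsManifold.maximalAtlas (𝓡 n) ∞ N) :
    IsCoordMetric (metricCoord h e) e.target where
  isOpen := e.open_target
  smooth := matSmoothOn_metricCoord he
  symm x _ := by
    ext i j
    exact h.symm _ _ _
  det_ne x hx hdet := by
    -- A kernel vector has zero length, so positivity makes its image under the derivative of
    -- `e.symm` vanish, contradicting injectivity of that derivative.
    obtain ⟨v, hv, hv0⟩ := Matrix.exists_mulVec_eq_zero_iff.2 hdet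
    have h1 : ip (metricCoord h e x) v v = 0 := by rw [ip_eq, hv0, dotProduct_zero]
    rw [ip_metricCoord] at h1
    have h2 : mfderiv (𝓡 n) (𝓡 n) e.symm x (WithLp.toLp 2 v : Coord n) = 0 := by
      by_contra h0
      exact (h.pos _ _ h0).ne' h1
    have h3 := mfderiv_chart_symm he hx (WithLp.toLp 2 v)
    rw [h2, map_zero] at h3
    exact hv (congrArg WithLp.ofLp h3.symm)

theorem IsCoordMetric.mono {G : Coord n → Matrix (Fin n) (Fin n) ℝ} {Ω Ω₁ : Set (Coord n)}
    (hG : IsCoordMetric G Ω) (hΩ : IsOpen Ω₁) (hsub : Ω₁ ⊆ Ω) : IsCoordMetric G Ω₁ where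
  isOpen := hΩ
  smooth k l := (hG.smooth k l).mono hsub
  symm x hx := hG.symm x (hsub hx)
  det_ne x hx := hG.det_ne x (hsub hx)

end Charts

/-! ### Maps and isometric immersions read in charts. -/

section ChartDomain

variable {m n : ℕ} {M N : Type*} [TopologicalSpace M] [TopologicalSpace N] {φ : M → N}
  {e : OpenPartialHomeomorph M (Coord m)} {e' : OpenPartialHomeomorph N (Coord n)}

/-- The domain on which a map is expressed in charts. -/
def chartDomain (φ : M → N) (e : OpenPartialHomeomorph M (Coord m))
    (e' : OpenPartialHomeomorph N (Coord n)) : Set (Coord m) :=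
  e.target ∩ e.symm ⁻¹' (φ ⁻¹' e'.source)

theorem mem_chartDomain {p : M} (hp : p ∈ e.source) (hp' : φ p ∈ e'.source) :
    e p ∈ chartDomain φ e e' :=
  ⟨e.map_source hp, by simpa [e.left_inv hp] using hp'⟩

theorem isOpen_chartDomain (hφ : Continuous φ) : IsOpen (chartDomain φ e e') :=
  e.isOpen_inter_preimage_symm (e'.open_source.preimage hφ)

theorem mapCoord_apply {p : M} (hp : p ∈ e.source) : mapCoord φ e e' (e p) = e' (φ p) := by
  rw [mapCoord, e.left_inv hp]

end ChartDomain

section Immersion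

open scoped Matrix Topology

variable {m n : ℕ} {M N : Type*}
  [TopologicalSpace M] [ChartedSpace (Coord m) M] [TopologicalSpace N] [ChartedSpace (Coord n) N]
  {φ : M → N} {e : OpenPartialHomeomorph M (Coord m)} {e' : OpenPartialHomeomorph N (Coord n)}

theorem isCoordMap_mapCoord (hφ : ContMDiff (𝓡 m) (𝓡 n) ∞ φ)
    (he : e ∈ IsManifold.maximalAtlas (𝓡 m) ∞ M) (he' : e' ∈ IsManifold.maximalAtlas (𝓡 n) ∞ N) :
    IsCoordMap (mapCoord φ e e') (chartDomain φ e e') e'.target where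
  isOpen := isOpen_chartDomain hφ.continuous
  smooth := by
    rw [← contMDiffOn_iff_contDiffOn]
    have h1 : ContMDiffOn (𝓡 m) (𝓡 n) ∞ (φ ∘ e.symm) (chartDomain φ e e') :=
      hφ.comp_contMDiffOn ((contMDiffOn_symm_of_mem_maximalAtlas he).mono Set.inter_subset_left)
    exact (contMDiffOn_of_mem_maximalAtlas he').comp h1 fun x hx => hx.2
  mapsTo x hx := e'.map_source hx.2

theorem mapDeriv_mapCoord (hφ : ContMDiff (𝓡 m) (𝓡 n) ∞ φ)
    (he : e ∈ IsManifold.maximalAtlas (𝓡 m) ∞ M) (he' : e' ∈ IsManifold.maximalAtlas (𝓡 n) ∞ N)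
    {x : Coord m} (hx : x ∈ chartDomain φ e e') (i : Fin m) :
    mapDeriv (mapCoord φ e e') i x = vecCoord e' (mfderiv (𝓡 m) (𝓡 n) φ (e.symm x)
      (mfderiv (𝓡 m) (𝓡 m) e.symm x (EuclideanSpace.single i (1 : ℝ) : Coord m))) := by
  have h1 : MDifferentiableAt (𝓡 m) (𝓡 m) e.symm x :=
    (contMDiffAt_symm_of_mem_maximalAtlas he hx.1).mdifferentiableAt (by simp)
  have h2 : MDifferentiableAt (𝓡 m) (𝓡 n) φ (e.symm x) :=
    hφ.contMDiffAt.mdifferentiableAt (by simp)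
  have h3 : MDifferentiableAt (𝓡 n) (𝓡 n) e' (φ (e.symm x)) :=
    (contMDiffAt_of_mem_maximalAtlas he' hx.2).mdifferentiableAt (by simp)
  have h4 := (h3.hasMFDerivAt.comp x (h2.hasMFDerivAt.comp x h1.hasMFDerivAt))
  have h5 : HasFDerivAt (mapCoord φ e e') _ x := hasMFDerivAt_iff_hasFDerivAt.1 h4
  ext γ
  have h6 := (EuclideanSpace.proj (𝕜 := ℝ) γ).hasFDerivAt.comp x h5
  rw [mapDeriv, pderiv]
  erw [h6.fderiv]
  rfl

variable [IsManifold (𝓡 m) ∞ M] [IsManifold (𝓡 n) ∞ N] {g : Metric m M} {h : Metric n N}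

theorem isometric_mapCoord (hφ : IsIsometricImmersion g h φ)
    (he : e ∈ IsManifold.maximalAtlas (𝓡 m) ∞ M) (he' : e' ∈ IsManifold.maximalAtlas (𝓡 n) ∞ N)
    {x : Coord m} (hx : x ∈ chartDomain φ e e') (i j : Fin m) :
    ip (metricCoord h e' (mapCoord φ e e' x)) (mapDeriv (mapCoord φ e e') i x)
      (mapDeriv (mapCoord φ e e') j x) = metricCoord g e x i j := by
  rw [mapDeriv_mapCoord hφ.1 he he' hx, mapDeriv_mapCoord hφ.1 he he' hx, mapCoord,
    ← inner_eq_ip he' hx.2, hφ.2]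
  rfl

end Immersion

/-! ### From the hypersurface on manifolds to its coordinate form. -/

section Hypersurface

open scoped Matrix Topology

variable {m : ℕ} {M N : Type*}
  [TopologicalSpace M] [ChartedSpace (Coord m) M] [IsManifold (𝓡 m) ∞ M]
  [TopologicalSpace N] [ChartedSpace (Coord (m + 1)) N] [IsManifold (𝓡 (m + 1)) ∞ N]
  {g : Metric m M} {h : Metric (m + 1) N} {φ : M → N}
  {e : OpenPartialHomeomorph M (Coord m)} {e' : OpenPartialHomeomorph N (Coord (m + 1))}

theorem secondFundamental_apply {p : M} (hp : p ∈ e.source) (ξ : TangentSpace (𝓡 (m + 1)) (φ p))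
    (i j : Fin m) :
    secondFundamental g h φ p ξ e e' i j
      = ip (metricCoord h e' (mapCoord φ e e' (e p)))
        (hessMap (metricCoord g e) (metricCoord h e') (mapCoord φ e e') i j (e p))
        (vecCoord e' ξ) := by
  rw [ip_eq_sum, mapCoord_apply hp]
  rfl

theorem isUmbilicAt_of_factor (hφ : IsIsometricImmersion g h φ)
    (he : e ∈ IsManifold.maximalAtlas (𝓡 m) ∞ M)
    (he' : e' ∈ IsManifold.maximalAtlas (𝓡 (m + 1)) ∞ N) {p : M} (hp : p ∈ e.source)
    (hp' : φ p ∈ e'.source) {ξ : TangentSpace (𝓡 (m + 1)) (φ p)} {lam : ℝ}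
    (hξ : IsUnitNormal (m := m) h φ p ξ) (hlam : IsUmbilicityFactor g h φ p ξ lam) :
    IsUmbilicAt (metricCoord g e) (metricCoord h e') (mapCoord φ e e') (e p) (vecCoord e' ξ)
      lam where
  normal i := by
    have hx := mem_chartDomain hp hp'
    rw [mapDeriv_mapCoord hφ.1 he he' hx, mapCoord_apply hp]
    have key (p' : M) (hpp : p' = p) (v : TangentSpace (𝓡 m) p') :
        ip (metricCoord h e' (e' (φ p))) (vecCoord e' ξ)
          (vecCoord e' (mfderiv (𝓡 m) (𝓡 (m + 1)) φ p' v)) = 0 := by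
      subst hpp
      rw [← inner_eq_ip he' hp']
      exact hξ.1 v
    exact key _ (e.left_inv hp) _
  unit := by
    rw [mapCoord_apply hp, ← inner_eq_ip he' hp']
    exact hξ.2
  second i j := by
    rw [← secondFundamental_apply hp]
    have h1 := hlam e he e' he' hp hp'
    rw [shapeOperator] at h1
    -- Lowering an index turns G⁻¹b = λ Id into b = λG.
    have h2 := congrArg (metricCoord g e (e p) * ·) h1
    simp only [← Matrix.mul_assoc, (isCoordMetric_metricCoord he).mul_inv (e.map_source hp)] at h2
    rw [Matrix.one_mul, Matrix.mul_smul, Matrix.mul_one] at h2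
    rw [h2]
    rfl

theorem isUmbilicalHypersurface_mapCoord (hφ : IsIsometricImmersion g h φ)
    (hM : IsTotallyUmbilical g h φ) (he : e ∈ IsManifold.maximalAtlas (𝓡 m) ∞ M)
    (he' : e' ∈ IsManifold.maximalAtlas (𝓡 (m + 1)) ∞ N) :
    IsUmbilicalHypersurface (metricCoord g e) (metricCoord h e') (mapCoord φ e e')
      (chartDomain φ e e') e'.target where
  source := (isCoordMetric_metricCoord he).mono (isOpen_chartDomain hφ.1.continuous)
    Set.inter_subset_left
  target := isCoordMetric_metricCoord he'
  map := isCoordMap_mapCoord hφ.1 he he'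
  isometric _ hx := isometric_mapCoord hφ he he' hx
  umbilical x hx := by
    obtain ⟨ξ, hξ, lam, hlam⟩ := hM (e.symm x)
    have := isUmbilicAt_of_factor hφ he he' (e.map_target hx.1) hx.2 hξ hlam
    rw [e.right_inv hx.1] at this
    exact ⟨_, _, this⟩

end Hypersurface

/-! ### Global consequences: minimality and constancy of the factor. -/

section Global

open scoped Matrix Topology

variable {m : ℕ} {M N : Type*}
  [TopologicalSpace N] [ChartedSpace (Coord (m + 1)) N] [IsManifold (𝓡 (m + 1)) ∞ N]
  {h : Metric (m + 1) N} {φ : M → N} {e' : OpenPartialHomeomorph N (Coord (m + 1))}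

theorem IsEinstein.ricci_chart (hN : IsEinstein h)
    (he' : e' ∈ IsManifold.maximalAtlas (𝓡 (m + 1)) ∞ N) {q : N} (hq : q ∈ e'.source) :
    ricci (metricCoord h e') (e' q)
      = (scalar (metricCoord h e') (e' q) / ((m : ℝ) + 1)) • metricCoord h e' (e' q) := by
  have := hN e' he' q hq
  rwa [Nat.cast_add_one] at this

variable [TopologicalSpace M] [ChartedSpace (Coord m) M]

/-- In the preferred chart at φ p₀, the components of ξ are its fibre coordinates in the tangent
bundle trivialization at φ p₀, which depend continuously on p. -/
theorem continuousWithinAt_vecCoord (hφ : Continuous φ) {U : Set M}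
    {ξ : ∀ p : M, TangentSpace (𝓡 (m + 1)) (φ p)}
    (hξ : ContMDiffOn (𝓡 m) (𝓡 (m + 1)).tangent ∞
      (fun p => (⟨φ p, ξ p⟩ : TangentBundle (𝓡 (m + 1)) N)) U) {p₀ : M} (hp₀ : p₀ ∈ U) :
    ContinuousWithinAt (fun p => vecCoord (chartAt (Coord (m + 1)) (φ p₀)) (ξ p)) U p₀ := by
  have h1 := hξ p₀ hp₀
  simp only [Bundle.contMDiffWithinAt_totalSpace] at h1
  have hev : ∀ p, φ p ∈ (chartAt (Coord (m + 1)) (φ p₀)).source →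
      vecCoord (chartAt (Coord (m + 1)) (φ p₀)) (ξ p)
        = (trivializationAt (Coord (m + 1)) (TangentSpace (𝓡 (m + 1))) (φ p₀)
          ⟨φ p, ξ p⟩).2 := by
    intro p hp
    rw [vecCoord, mfderiv_chartAt_eq_tangentCoordChange hp]
    rfl
  refine h1.2.continuousWithinAt.congr_of_eventuallyEq ?_
    (hev p₀ (mem_chart_source (Coord (m + 1)) (φ p₀)))
  refine Filter.Eventually.filter_mono nhdsWithin_le_nhds ?_
  filter_upwards [((chartAt (Coord (m + 1)) (φ p₀)).open_source.preimage
    hφ).mem_nhds (mem_chart_source (Coord (m + 1)) (φ p₀))] with p hp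
  exact hev p hp

variable [IsManifold (𝓡 m) ∞ M] {g : Metric m M} {e : OpenPartialHomeomorph M (Coord m)}

theorem IsBiharmonic.bitension_mapCoord (hb : IsBiharmonic g h φ)
    (he : e ∈ IsManifold.maximalAtlas (𝓡 m) ∞ M)
    (he' : e' ∈ IsManifold.maximalAtlas (𝓡 (m + 1)) ∞ N) {x : Coord m}
    (hx : x ∈ chartDomain φ e e') :
    bitension (metricCoord g e) (metricCoord h e') (mapCoord φ e e') x = 0 := by
  ext γ
  have := hb e he e' he' (e.symm x) (e.map_target hx.1) hx.2 γ
  rwa [e.right_inv hx.1] at this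

variable (hφ : IsIsometricImmersion g h φ) (hN : IsEinstein h) (hM : IsTotallyUmbilical g h φ)
include hφ hM

section Biharmonic

variable (hb : IsBiharmonic g h φ)
include hN hb

theorem pderiv_tensionSq_mapCoord (he : e ∈ IsManifold.maximalAtlas (𝓡 m) ∞ M)
    (he' : e' ∈ IsManifold.maximalAtlas (𝓡 (m + 1)) ∞ N) {x : Coord m}
    (hx : x ∈ chartDomain φ e e') (i : Fin m) :
    pderiv i (tensionSq (metricCoord g e) (metricCoord h e') (mapCoord φ e e')) x = 0 :=
  (isUmbilicalHypersurface_mapCoord hφ hM he he').pderiv_tensionSq_eq_zero hx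
    (hN.ricci_chart he' hx.2) (hb.bitension_mapCoord he he' hx) i

/-- The umbilicity factor of a biharmonic hypersurface is `0` or determined by the scalar
curvature. -/
theorem umbilicityFactor_eq_zero_or (hm : 1 ≤ m) {p : M} {ξ : TangentSpace (𝓡 (m + 1)) (φ p)}
    {lam : ℝ} (hξ : IsUnitNormal (m := m) h φ p ξ) (hlam : IsUmbilicityFactor g h φ p ξ lam) :
    lam = 0 ∨ m * lam ^ 2 = scalarCurvature h (φ p) / ((m : ℝ) + 1) := by
  -- The preferred charts are used because `scalarCurvature` is computed in them; no chart
  -- independence is needed.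
  have he := IsManifold.chart_mem_maximalAtlas (I := 𝓡 m) (n := ∞) p
  have he' := IsManifold.chart_mem_maximalAtlas (I := 𝓡 (m + 1)) (n := ∞) (φ p)
  have hp := mem_chart_source (Coord m) p
  have hp' := mem_chart_source (Coord (m + 1)) (φ p)
  have hx := mem_chartDomain hp hp'
  have h1 := (isUmbilicalHypersurface_mapCoord hφ hM he he').factor_eq_zero_or hx
    (hN.ricci_chart he' hx.2) (hb.bitension_mapCoord he he' hx)
    (fun z hz i => pderiv_tensionSq_mapCoord hφ hN hM hb he he' hz i)
    (isUmbilicAt_of_factor hφ he he' hp hp' hξ hlam) hm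
  rwa [OpenPartialHomeomorph.left_inv _ hp] at h1

/-- ρ = m²λ² has zero derivative, hence is constant on a coordinate ball. Squaring removes the sign
of the normal, so no continuous choice of ξ enters. -/
theorem eventually_umbilicityFactor_sq_eq (hm : 1 ≤ m) {p₀ : M}
    {ξ₀ : TangentSpace (𝓡 (m + 1)) (φ p₀)} {lam₀ : ℝ} (hξ₀ : IsUnitNormal (m := m) h φ p₀ ξ₀)
    (hlam₀ : IsUmbilicityFactor g h φ p₀ ξ₀ lam₀) :
    ∀ᶠ p in 𝓝 p₀, ∀ (ξ : TangentSpace (𝓡 (m + 1)) (φ p)) (lam : ℝ),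
      IsUnitNormal (m := m) h φ p ξ → IsUmbilicityFactor g h φ p ξ lam → lam ^ 2 = lam₀ ^ 2 := by
  have he := IsManifold.chart_mem_maximalAtlas (I := 𝓡 m) (n := ∞) p₀
  have he' := IsManifold.chart_mem_maximalAtlas (I := 𝓡 (m + 1)) (n := ∞) (φ p₀)
  have hp₀ := mem_chart_source (Coord m) p₀
  have hp₀' := mem_chart_source (Coord (m + 1)) (φ p₀)
  set e := chartAt (Coord m) p₀
  set e' := chartAt (Coord (m + 1)) (φ p₀)
  have hS := isUmbilicalHypersurface_mapCoord hφ hM he he'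
  obtain ⟨r, hr, hball⟩ := Metric.isOpen_iff.1 hS.source.isOpen _ (mem_chartDomain hp₀ hp₀')
  have hc : ContinuousAt e p₀ := e.continuousAt hp₀
  filter_upwards [e.open_source.mem_nhds hp₀,
    hc.preimage_mem_nhds (Metric.ball_mem_nhds _ hr),
    (e'.open_source.preimage hφ.1.continuous).mem_nhds hp₀'] with p hp hpr hp' ξ lam hξ hlam
  have hconst := Metric.isOpen_ball.is_const_of_fderiv_eq_zero (𝕜 := ℝ)
    (convex_ball (e p₀) r).isPreconnected
    (fun z hz => (differentiableAt_of_contDiffOn hS.source.isOpen hS.contDiffOn_tensionSq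
      (hball hz)).differentiableWithinAt)
    (fun z hz => by
      ext v
      rw [fderiv_eq_sum_pderiv]
      simp [pderiv_tensionSq_mapCoord hφ hN hM hb he he' (hball hz)])
    hpr (Metric.mem_ball_self hr)
  rw [tensionSq, hS.norm_sq_tension (hball hpr) (isUmbilicAt_of_factor hφ he he' hp hp' hξ hlam),
    tensionSq, hS.norm_sq_tension (mem_chartDomain hp₀ hp₀')
      (isUmbilicAt_of_factor hφ he he' hp₀ hp₀' hξ₀ hlam₀), mul_pow, mul_pow] at hconst
  exact mul_left_cancel₀ (by positivity) hconst

theorem IsBiharmonic.isMinimal (hr : ∀ q : N, scalarCurvature h q ≤ 0) : IsMinimal g h φ := by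
  intro p ξ hξ e he e' he' hp hp'
  rcases Nat.eq_zero_or_pos m with rfl | hm
  · simp
  -- Minimality tests every unit normal ξ, umbilicity supplies one ξ₀. A zero factor for ξ₀ makes
  -- ∇dφ itself vanish, which covers every ξ.
  obtain ⟨ξ₀, hξ₀, lam, hlam⟩ := hM p
  have h0 : lam = 0 := by
    refine (umbilicityFactor_eq_zero_or hφ hN hM hb hm hξ₀ hlam).elim id fun h1 => ?_
    have h2 : scalarCurvature h (φ p) / ((m : ℝ) + 1) ≤ 0 :=
      div_nonpos_of_nonpos_of_nonneg (hr _) (by positivity)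
    have h3 : (0 : ℝ) < m := by positivity
    have h4 : lam ^ 2 ≤ 0 := by
      by_contra h5
      have := mul_pos h3 (not_le.1 h5)
      linarith
    exact pow_eq_zero_iff (two_ne_zero) |>.1 (le_antisymm h4 (sq_nonneg _))
  have hS := isUmbilicalHypersurface_mapCoord hφ hM he he'
  have hν := isUmbilicAt_of_factor hφ he he' hp hp' hξ₀ hlam
  have h1 : secondFundamental g h φ p ξ e e' = 0 := by
    ext i j
    rw [secondFundamental_apply hp, hS.hessMap_eq (mem_chartDomain hp hp') hν, h0]
    simp
  rw [shapeOperator, h1]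
  simp

end Biharmonic

theorem IsMinimal.isBiharmonic (hmin : IsMinimal g h φ) : IsBiharmonic g h φ := by
  intro e he e' he' p hp hp' γ
  have hS := isUmbilicalHypersurface_mapCoord hφ hM he he'
  have hT : ∀ z ∈ chartDomain φ e e',
      tension (metricCoord g e) (metricCoord h e') (mapCoord φ e e') z = 0 := by
    intro z hz
    obtain ⟨ξ, hξ, lam, hlam⟩ := hM (e.symm z)
    have h1 := hmin _ ξ hξ e he e' he' (e.map_target hz.1) hz.2
    rw [hlam e he e' he' (e.map_target hz.1) hz.2, Matrix.trace_smul, Matrix.trace_one,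
      Fintype.card_fin, smul_eq_mul] at h1
    have hν := isUmbilicAt_of_factor hφ he he' (e.map_target hz.1) hz.2 hξ hlam
    rw [e.right_inv hz.1] at hν
    have h2 : (m : ℝ) * lam = 0 := by
      rcases eq_or_ne (m : ℝ) 0 with h0 | h0
      · rw [h0, zero_mul]
      · field_simp at h1
        rw [h1, mul_zero]
    rw [hS.tension_eq_smul hz hν, h2, zero_smul]
  rw [bitension_eq_zero_of_tension_eq_zero hS.source.isOpen hT (mem_chartDomain hp hp')]
  rfl

/-- τ = mλξ gives λ = (1/m)⟨τ, ξ⟩, a pairing of a smooth field with a continuous one. -/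
theorem continuousOn_umbilicityFactor (hm : 1 ≤ m) {U : Set M}
    {ξ : ∀ p : M, TangentSpace (𝓡 (m + 1)) (φ p)} {lam : M → ℝ}
    (hξ : ContMDiffOn (𝓡 m) (𝓡 (m + 1)).tangent ∞
      (fun p => (⟨φ p, ξ p⟩ : TangentBundle (𝓡 (m + 1)) N)) U)
    (hlam : ∀ p ∈ U, IsUnitNormal (m := m) h φ p (ξ p) ∧
      IsUmbilicityFactor g h φ p (ξ p) (lam p)) :
    ContinuousOn lam U := by
  intro p₀ hp₀U
  have he := IsManifold.chart_mem_maximalAtlas (I := 𝓡 m) (n := ∞) p₀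
  have he' := IsManifold.chart_mem_maximalAtlas (I := 𝓡 (m + 1)) (n := ∞) (φ p₀)
  have hv := continuousWithinAt_vecCoord hφ.1.continuous hξ hp₀U
  have hp₀ := mem_chart_source (Coord m) p₀
  have hp₀' := mem_chart_source (Coord (m + 1)) (φ p₀)
  set e := chartAt (Coord m) p₀
  set e' := chartAt (Coord (m + 1)) (φ p₀)
  have hS := isUmbilicalHypersurface_mapCoord hφ hM he he'
  have hx := mem_chartDomain hp₀ hp₀'
  have hc : ContinuousAt e p₀ := e.continuousAt hp₀
  have heq : ∀ p ∈ U, p ∈ e.source → φ p ∈ e'.source → lam p = (1 / (m : ℝ)) *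
      ip (metricCoord h e' (mapCoord φ e e' (e p)))
        (tension (metricCoord g e) (metricCoord h e') (mapCoord φ e e') (e p))
        (vecCoord e' (ξ p)) := by
    intro p hpU hp hp'
    have hν := isUmbilicAt_of_factor hφ he he' hp hp' (hlam p hpU).1 (hlam p hpU).2
    rw [hS.tension_eq_smul (mem_chartDomain hp hp') hν, LinearMap.map_smul₂, hν.unit]
    field_simp
    simp
  have hcont : ContinuousWithinAt (fun p => (1 / (m : ℝ)) *
      ip (metricCoord h e' (mapCoord φ e e' (e p)))
        (tension (metricCoord g e) (metricCoord h e') (mapCoord φ e e') (e p))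
        (vecCoord e' (ξ p))) U p₀ := by
    simp only [ip_eq_sum]
    have hd {f : Coord m → ℝ} (hf : ContDiffOn ℝ ∞ f (chartDomain φ e e')) :
        ContinuousWithinAt (fun p => f (e p)) U p₀ :=
      ((differentiableAt_of_contDiffOn hS.source.isOpen hf hx).continuousAt.comp
        hc).continuousWithinAt
    refine continuousWithinAt_const.mul (tendsto_finsetSum _ fun a _ =>
      tendsto_finsetSum _ fun b _ => ?_)
    refine ((hd (hS.map.smooth_metric hS.target a b)).mul (hd (hS.smooth_tension a))).mul ?_
    exact (EuclideanSpace.proj (𝕜 := ℝ) b).continuous.continuousAt.comp_continuousWithinAt hv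
  refine hcont.congr_of_eventuallyEq ?_ (heq p₀ hp₀U hp₀ hp₀')
  filter_upwards [self_mem_nhdsWithin, nhdsWithin_le_nhds (e.open_source.mem_nhds hp₀),
    nhdsWithin_le_nhds ((e'.open_source.preimage hφ.1.continuous).mem_nhds hp₀')] with p h1 h2 h3
  exact heq p h1 h2 h3

-- λ² is locally constant, hence constant on a preconnected set. A continuous λ with constant
-- nonzero square keeps one sign there.
include hN in
theorem IsBiharmonic.exists_umbilicityFactor_eq (hb : IsBiharmonic g h φ) (hm : 1 ≤ m) {U : Set M}
    {ξ : ∀ p : M, TangentSpace (𝓡 (m + 1)) (φ p)} {lam : M → ℝ} (hU : IsPreconnected U)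
    (hξ : ContMDiffOn (𝓡 m) (𝓡 (m + 1)).tangent ∞
      (fun p => (⟨φ p, ξ p⟩ : TangentBundle (𝓡 (m + 1)) N)) U)
    (hlam : ∀ p ∈ U, IsUnitNormal (m := m) h φ p (ξ p) ∧
      IsUmbilicityFactor g h φ p (ξ p) (lam p)) :
    ∃ c : ℝ, ∀ p ∈ U, lam p = c := by
  rcases U.eq_empty_or_nonempty with rfl | ⟨p₀, hp₀⟩
  · exact ⟨0, by simp⟩
  have hsq : ∀ p ∈ U, lam p ^ 2 = lam p₀ ^ 2 := by
    intro p hp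
    have hloc : IsLocallyConstant (fun q : U => lam q ^ 2) := by
      rw [IsLocallyConstant.iff_eventually_eq]
      intro q
      have := eventually_umbilicityFactor_sq_eq hφ hN hM hb hm (hlam q q.2).1 (hlam q q.2).2
      filter_upwards [continuous_subtype_val.continuousAt.eventually this] with q' hq'
      exact hq' _ _ (hlam q' q'.2).1 (hlam q' q'.2).2
    have : PreconnectedSpace U := isPreconnected_iff_preconnectedSpace.1 hU
    exact hloc.apply_eq_of_isPreconnected isPreconnected_univ
      (Set.mem_univ (⟨p, hp⟩ : U)) (Set.mem_univ ⟨p₀, hp₀⟩)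
  refine ⟨lam p₀, fun p hp => ?_⟩
  by_cases h0 : lam p₀ = 0
  · rw [h0]
    simpa [h0] using hsq p hp
  rcases hU.eq_or_eq_neg_of_sq_eq (f := lam) (g := fun _ => lam p₀)
    (continuousOn_umbilicityFactor hφ hM hm hξ hlam) continuousOn_const
    (fun q hq => hsq q hq) (fun _ => h0) with h1 | h1
  · exact h1 hp
  · have h2 : lam p₀ = -lam p₀ := h1 hp₀
    exact absurd (self_eq_neg.1 h2) h0

end Global

end BihHyp

/-! ### Assembly of the two statements. -/

open BihHyp
theorem mainTheorem2 {m : ℕ} {M N : Type*}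
    [TopologicalSpace M] [ChartedSpace (Coord m) M] [IsManifold (𝓡 m) ∞ M]
    [TopologicalSpace N] [ChartedSpace (Coord (m + 1)) N] [IsManifold (𝓡 (m + 1)) ∞ N]
    (g : Metric m M) (h : Metric (m + 1) N) (φ : M → N)
    (hφ : IsIsometricImmersion g h φ) (hN : IsEinstein h) (hM : IsTotallyUmbilical g h φ) :
    ((∀ q : N, scalarCurvature h q ≤ 0) → (IsBiharmonic g h φ ↔ IsMinimal g h φ)) ∧
    (1 ≤ m → IsBiharmonic g h φ →
      ∀ (U : Set M) (ξ : ∀ p : M, TangentSpace (𝓡 (m + 1)) (φ p)) (lam : M → ℝ),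
        IsOpen U → IsPreconnected U →
        ContMDiffOn (𝓡 m) (𝓡 (m + 1)).tangent ∞
          (fun p => (⟨φ p, ξ p⟩ : TangentBundle (𝓡 (m + 1)) N)) U →
        (∀ p ∈ U, IsUnitNormal (m := m) h φ p (ξ p) ∧ IsUmbilicityFactor g h φ p (ξ p) (lam p)) →
        ∃ c : ℝ, (∀ p ∈ U, lam p = c) ∧
          (c = 0 ∨ ∀ p ∈ U, 0 ≤ scalarCurvature h (φ p) ∧
            (c = √(scalarCurvature h (φ p) / (m * (m + 1))) ∨
              c = -√(scalarCurvature h (φ p) / (m * (m + 1)))))) := by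
  refine ⟨fun hr => ⟨fun hb => hb.isMinimal hφ hN hM hr, fun hmin => hmin.isBiharmonic hφ hM⟩,
    fun hm hb U ξ lam _ hU hξ hlam => ?_⟩
  obtain ⟨c, hc⟩ := hb.exists_umbilicityFactor_eq hφ hN hM hm hU hξ hlam
  refine ⟨c, hc, or_iff_not_imp_left.2 fun h0 p hp => ?_⟩
  have h1 := umbilicityFactor_eq_zero_or hφ hN hM hb hm (hlam p hp).1 (hlam p hp).2
  rw [hc p hp] at h1
  have h2 := h1.resolve_left h0
  have hm0 : (0 : ℝ) < m := by positivity
  -- With c ≠ 0 the normal equation reads mc² = r/(m+1); this gives both r ≥ 0 and the two square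
  -- roots.
  have h3 : scalarCurvature h (φ p) = c ^ 2 * (m * (m + 1)) := by
    field_simp at h2
    linarith
  have h4 : scalarCurvature h (φ p) / (m * (m + 1)) = c ^ 2 := by
    rw [h3]
    field_simp
  refine ⟨by rw [h3]; positivity, ?_⟩
  rw [h4, Real.sqrt_sq_eq_abs]
  rcases abs_choice c with h5 | h5 <;> rw [h5]
  · exact Or.inl rfl
  · exact Or.inr (neg_neg c).symm
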